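/- Conventions. Manifolds are smooth ($C^\infty$), Hausdorff and second countable (except that the arrow space of a Lie groupoid need not be Hausdorff or second countable), submanifolds are embedded, and $X$ is a second countable Hausdorff space. An $n$-dimensional orbifold chart $(U,\widetilde U/\Gamma,\pi)$ on $X$ consists of an open set $U\subset X$, a connected $n$-manifold $\widetilde U$, a finite group $\Gamma$ acting smoothly and effectively on $\widetilde U$, and a continuous $\Gamma$-invariant map $\pi:\widetilde U\to U$ inducing a homeomorphism $\widetilde U/\Gamma\to U$. An injection between charts is a smooth embedding commuting with the projections to $X$. Two charts are compatible if every $x\in U_1\cap U_2$ lies in the image $W\subset U_1\cap U_2$ of a chart that has injections into both; an atlas is a family of pairwise compatible charts covering $X$, and an orbifold $(X,\mathcal A)$ is $X$ with a maximal atlas. For a countable atlas $\mathcal A=\{(U_i,\widetilde U_i/\Gamma_i,\pi_i)\}_{i\in I}$, the germ groupoid $\mathcal G(\mathcal A)$ is the Lie groupoid with objects $\coprod_i\widetilde U_i$ and with arrows the germs $[f]_p:p\to f(p)$ of diffeomorphisms $f$ between open subsets of $\coprod_i\widetilde U_i$ with $\pi\circ f=\pi$, where $\pi=\coprod_i\pi_i$;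 the topology and smooth structure on the arrows are those for which each bijection $p\mapsto[f]_p$ from $\mathrm{dom} f$ onto the set of germs of $f$ is a diffeomorphism onto an open set. Write $|\mathcal G(\mathcal A)|$ for its orbit space and $\varepsilon_{\mathcal A}:|\mathcal G(\mathcal A)|\to X$ for the map sending the orbit of $p$ to $\pi(p)$. A Lie groupoid embedding is a Lie groupoid morphism $\Phi=(\Phi_0,\Phi_1)$ with $\Phi_0,\Phi_1$ smooth embeddings; $|\Phi|$ is the induced map on orbit spaces. Let $Y\subset X$. A closed $k$-dimensional suborbifold cover on $Y$ with respect to $\mathcal A$ consists of $J\subset I$ and connected closed $k$-dimensional submanifolds $\widetilde V_j\subset\widetilde U_j$ ($j\in J$) such that $\pi_j(\widetilde V_j)$ is open in $Y$, $\bigcup_j\pi_j(\widetilde V_j)=Y$, and for each $j$ there is a subgroup $\Delta_j\subset\Gamma_j$ for which $\widetilde V_j$ is a $\Delta_j$-submanifold, i.e. $\widetilde V_j$ is $\Delta_j$-invariant and whenever $p,\gamma p\in\widetilde V_j$ with $\gamma\in\Gamma_j$ there is $\delta\in\Delta_j$ with $\delta p=\gamma p$. The induced atlas on $Y$ is $\mathcal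 B=\{(\pi_j(\widetilde V_j),\widetilde V_j/(\Delta_j/K_j),\pi_j|_{\widetilde V_j})\}_{j\in J}$, with $K_j$ the kernel of the action of $\Delta_j$ on $\widetilde V_j$. The cover is strong if there is a Lie groupoid embedding $\Phi:\mathcal G(\mathcal B)\to\mathcal G(\mathcal A)$ such that $\varepsilon_{\mathcal A}\circ|\Phi|$ equals $\varepsilon_{\mathcal B}$ followed by the inclusion $Y\hookrightarrow X$. It is very strong if (1) whenever $j\in J$ and $\gamma\in\Gamma_j$ fixes some non-empty open subset of $\widetilde V_j$ pointwise, $\gamma=e$; and (2) for all $j_1,j_2\in J$ and $x\in\pi_{j_1}(\widetilde V_{j_1})\cap\pi_{j_2}(\widetilde V_{j_2})$ there are an $n$-dimensional orbifold chart $(W,\widetilde W/K,\sigma)$ on $X$, a subgroup $\Lambda\subset K$, a $k$-dimensional $\Lambda$-submanifold $\widetilde Z\subset\widetilde W$ such that $\sigma(\widetilde Z)$ is an open neighbourhood of $x$ in $Y$, and injections $\lambda_m:\widetilde W\to\widetilde U_{j_m}$ with $\lambda_m(\widetilde Z)\subset\widetilde V_{j_m}$, $m=1,2$. A subset $Y$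 of an orbifold $(X,\mathcal A)$ is a ($k$-dimensional) strong, respectively very strong, suborbifold if it has a strong, respectively very strong, closed $k$-dimensional suborbifold cover with respect to some countable atlas contained in $\mathcal A$. Theorem. (a) Let $\mathcal A$ be a countable $n$-dimensional orbifold atlas on $X$. Every very strong suborbifold cover on a subset $Y\subset X$ with respect to $\mathcal A$ is strong. Moreover, with $\mathcal B$ the induced atlas, there is a unique Lie groupoid embedding $\Phi:\mathcal G(\mathcal B)\to\mathcal G(\mathcal A)$ such that $\Phi_0:\coprod_{j\in J}\widetilde V_j\to\coprod_{i\in I}\widetilde U_i$ is the inclusion, and for this $\Phi$ the map $\varepsilon_{\mathcal A}\circ|\Phi|$ equals $\varepsilon_{\mathcal B}$ followed by the inclusion $Y\hookrightarrow X$. (b) Every $k$-dimensional very strong suborbifold of an $n$-dimensional orbifold $(X,\mathcal A)$ is a $k$-dimensional strong suborbifold. -/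

import Mathlib

open Set Topology Manifold
open scoped ContDiff

universe u v w

/-! ### Lie groupoids and their embeddings -/

/-- A Lie groupoid `Arr ⇉ Obj` with `dim Obj = d₀` and `dim Arr = d₁`. The space of arrows need not
be Hausdorff or second countable. The multiplication is smooth on the fibre product
`{(g, h) | src g = tgt h}`, an embedded submanifold of `Arr × Arr`. -/
structure LieGroupoid (d₀ d₁ : ℕ) where
  Obj : Type u
  Arr : Type v
  [topObj : TopologicalSpace Obj]
  [chartedObj : ChartedSpace (EuclideanSpace ℝ (Fin d₀)) Obj]
  [manifoldObj : IsManifold (𝓡 d₀) ∞ Obj]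
  [t2Obj : T2Space Obj]
  [secondCountableObj : SecondCountableTopology Obj]
  [topArr : TopologicalSpace Arr]
  [chartedArr : ChartedSpace (EuclideanSpace ℝ (Fin d₁)) Arr]
  [manifoldArr : IsManifold (𝓡 d₁) ∞ Arr]
  src : Arr → Obj
  tgt : Arr → Obj
  mul : ∀ g h : Arr, src g = tgt h → Arr
  unit : Obj → Arr
  inv : Arr → Arr
  src_submersion : IsSubmersion (𝓡 d₁) (𝓡 d₀) ∞ src
  tgt_submersion : IsSubmersion (𝓡 d₁) (𝓡 d₀) ∞ tgt
  smooth_mul : open Classical in ContMDiffOn ((𝓡 d₁).prod (𝓡 d₁)) (𝓡 d₁) ∞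
    (fun x : Arr × Arr => if h : src x.1 = tgt x.2 then mul x.1 x.2 h else x.1)
    {x | src x.1 = tgt x.2}
  smooth_unit : ContMDiff (𝓡 d₀) (𝓡 d₁) ∞ unit
  smooth_inv : ContMDiff (𝓡 d₁) (𝓡 d₁) ∞ inv
  src_mul : ∀ g h e, src (mul g h e) = src h
  tgt_mul : ∀ g h e, tgt (mul g h e) = tgt g
  mul_assoc : ∀ g h k (e : src g = tgt h) (e' : src h = tgt k),
    mul (mul g h e) k ((src_mul g h e).trans e') = mul g (mul h k e') (e.trans (tgt_mul h k e').symm)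
  src_unit : ∀ p, src (unit p) = p
  tgt_unit : ∀ p, tgt (unit p) = p
  mul_unit : ∀ g, mul g (unit (src g)) (tgt_unit (src g)).symm = g
  unit_mul : ∀ g, mul (unit (tgt g)) g (src_unit (tgt g)) = g
  src_inv : ∀ g, src (inv g) = tgt g
  tgt_inv : ∀ g, tgt (inv g) = src g
  mul_inv : ∀ g, mul g (inv g) (tgt_inv g).symm = unit (tgt g)
  inv_mul : ∀ g, mul (inv g) g (src_inv g) = unit (src g)

namespace LieGroupoid

attribute [instance] topObj chartedObj manifoldObj t2Obj secondCountableObj topArr chartedArr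
  manifoldArr

/-- Two objects are equivalent if there is an arrow from the first to the second. -/
def orbitSetoid {d₀ d₁ : ℕ} (G : LieGroupoid.{u, v} d₀ d₁) : Setoid G.Obj where
  r p q := ∃ g, G.src g = p ∧ G.tgt g = q
  iseqv :=
    { refl := fun p => ⟨G.unit p, G.src_unit p, G.tgt_unit p⟩
      symm := by
        rintro p q ⟨g, h₁, h₂⟩
        exact ⟨G.inv g, (G.src_inv g).trans h₂, (G.tgt_inv g).trans h₁⟩
      trans := by
        rintro p q r ⟨g, h₁, h₂⟩ ⟨g', h₁', h₂'⟩
        exact ⟨G.mul g' g (h₁'.trans h₂.symm), (G.src_mul _ _ _).trans h₁,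
          (G.tgt_mul _ _ _).trans h₂'⟩ }

/-- The orbit space `|G|`, with the quotient topology. -/
abbrev OrbitSpace {d₀ d₁ : ℕ} (G : LieGroupoid.{u, v} d₀ d₁) : Type u :=
  Quotient G.orbitSetoid

/-- A Lie groupoid morphism `H → G`. -/
@[ext]
structure Hom {d₀ d₁ e₀ e₁ : ℕ} (H : LieGroupoid.{u, v} d₀ d₁) (G : LieGroupoid.{u, v} e₀ e₁) where
  obj : H.Obj → G.Obj
  arr : H.Arr → G.Arr
  smooth_obj : ContMDiff (𝓡 d₀) (𝓡 e₀) ∞ obj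
  smooth_arr : ContMDiff (𝓡 d₁) (𝓡 e₁) ∞ arr
  src_arr : ∀ g, G.src (arr g) = obj (H.src g)
  tgt_arr : ∀ g, G.tgt (arr g) = obj (H.tgt g)
  arr_mul : ∀ g h (e : H.src g = H.tgt h), arr (H.mul g h e) =
    G.mul (arr g) (arr h) ((src_arr g).trans ((congrArg obj e).trans (tgt_arr h).symm))
  arr_unit : ∀ p, arr (H.unit p) = G.unit (obj p)
  arr_inv : ∀ g, arr (H.inv g) = G.inv (arr g)

namespace Hom

/-- A Lie groupoid morphism is an embedding if it is a smooth embedding (an immersion which is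
a homeomorphism onto its image) both on objects and on arrows. -/
structure IsEmbedding {d₀ d₁ e₀ e₁ : ℕ} {H : LieGroupoid.{u, v} d₀ d₁}
    {G : LieGroupoid.{u, v} e₀ e₁} (Φ : H.Hom G) : Prop where
  obj : IsSmoothEmbedding (𝓡 d₀) (𝓡 e₀) ∞ Φ.obj
  arr : IsSmoothEmbedding (𝓡 d₁) (𝓡 e₁) ∞ Φ.arr

/-- The map `|Φ| : |H| → |G|` between orbit spaces. -/
def orbitMap {d₀ d₁ e₀ e₁ : ℕ} {H : LieGroupoid.{u, v} d₀ d₁}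
    {G : LieGroupoid.{u, v} e₀ e₁} (Φ : H.Hom G) : H.OrbitSpace → G.OrbitSpace :=
  Quotient.map Φ.obj (by
    rintro p q ⟨g, h₁, h₂⟩
    exact ⟨Φ.arr g, (Φ.src_arr g).trans (congrArg Φ.obj h₁),
      (Φ.tgt_arr g).trans (congrArg Φ.obj h₂)⟩)

end Hom

end LieGroupoid

/-! ### A local diffeomorphism is a submersion -/

theorem isSubmersion_of_isLocalDiffeomorph {n : ℕ} {M N : Type*} [TopologicalSpace M]
    [ChartedSpace (EuclideanSpace ℝ (Fin n)) M] [IsManifold (𝓡 n) ∞ M] [TopologicalSpace N]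
    [ChartedSpace (EuclideanSpace ℝ (Fin n)) N] [IsManifold (𝓡 n) ∞ N] {f : M → N}
    (hf : IsLocalDiffeomorph (𝓡 n) (𝓡 n) ∞ f) : IsSubmersion (𝓡 n) (𝓡 n) ∞ f := by
  refine IsSubmersionOfComplement.isSubmersion (F := PUnit.{1}) fun x => ?_
  obtain ⟨Φ, hx, hΦ⟩ := hf x
  have hc : ContMDiffOn (𝓡 n) (𝓡 n) ∞ (chartAt (EuclideanSpace ℝ (Fin n)) (f x))
      (chartAt (EuclideanSpace ℝ (Fin n)) (f x)).source := contMDiffOn_chart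
  have hc' : ContMDiffOn (𝓡 n) (𝓡 n) ∞ (chartAt (EuclideanSpace ℝ (Fin n)) (f x)).symm
      (chartAt (EuclideanSpace ℝ (Fin n)) (f x)).target := contMDiffOn_chart_symm
  set φ := Φ.toOpenPartialHomeomorph
  set ψ := chartAt (EuclideanSpace ℝ (Fin n)) (f x)
  have hfx : f x ∈ ψ.source := mem_chart_source _ _
  refine IsSubmersionAtOfComplement.mk_of_charts
    (ContinuousLinearEquiv.prodUnique ℝ _ _).symm (φ ≫ₕ ψ) ψ ?_ hfx ?_ ?_ ?_ ?_
  · rw [OpenPartialHomeomorph.trans_source]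
    refine ⟨hx, ?_⟩
    rw [hΦ hx] at hfx
    exact hfx
  · apply OpenPartialHomeomorph.mem_maximalAtlas_of_contMDiffOn
    · rw [OpenPartialHomeomorph.trans_source]
      exact hc.comp (Φ.contMDiffOn_toFun.mono inter_subset_left) inter_subset_right
    · rw [OpenPartialHomeomorph.trans_target]
      exact ContMDiffOn.comp (t := φ.target) Φ.contMDiffOn_invFun (hc'.mono inter_subset_left)
        (fun y hy => hy.2)
  · exact IsManifold.chart_mem_maximalAtlas _
  · intro y hy
    rw [OpenPartialHomeomorph.trans_source] at hy
    rw [mem_preimage, hΦ hy.1]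
    exact hy.2
  · intro y hy
    simp only [OpenPartialHomeomorph.extend_target, OpenPartialHomeomorph.trans_target,
      modelWithCornersSelf_coe_symm, modelWithCornersSelf_coe, preimage_id_eq, id_eq,
      range_id, inter_univ] at hy
    simp only [OpenPartialHomeomorph.extend_coe, OpenPartialHomeomorph.extend_coe_symm,
      modelWithCornersSelf_coe_symm, modelWithCornersSelf_coe, Function.comp_apply, id_eq,
      OpenPartialHomeomorph.trans_symm_eq_symm_trans_symm, OpenPartialHomeomorph.coe_trans]
    have h1 : φ.symm (ψ.symm y) ∈ φ.source := φ.map_target hy.2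
    rw [hΦ h1]
    have h2 : Φ (φ.symm (ψ.symm y)) = ψ.symm y := φ.right_inv hy.2
    rw [h2, ψ.right_inv hy.1]
    rfl

/-! ### Germs of transitions -/

section Germs

variable {n : ℕ} {M : Type u} [TopologicalSpace M] [ChartedSpace (EuclideanSpace ℝ (Fin n)) M]
  {X : Type v}

variable (n) in
/-- The pseudogroup of transitions over `X`: diffeomorphisms `f` between open subsets of `M` such
that `π ∘ f = π` on the domain of `f`. (The values of `f` and `f.symm` off their domains carry no
information: only germs at points of the domain are used.) -/
structure IsTransition (π : M → X) (f : OpenPartialHomeomorph M M) : Prop where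
  smooth : ContMDiffOn (𝓡 n) (𝓡 n) ∞ f f.source
  smooth_symm : ContMDiffOn (𝓡 n) (𝓡 n) ∞ f.symm f.target
  comp_eq : ∀ p ∈ f.source, π (f p) = π p

namespace IsTransition

variable {π : M → X} {f g : OpenPartialHomeomorph M M}

theorem refl : IsTransition n π (OpenPartialHomeomorph.refl M) :=
  ⟨contMDiffOn_id, contMDiffOn_id, fun _ _ => rfl⟩

theorem symm (hf : IsTransition n π f) : IsTransition n π f.symm := by
  refine ⟨hf.smooth_symm, by simpa using hf.smooth, fun p hp => ?_⟩
  have h := hf.comp_eq _ (f.map_target hp)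
  rw [f.right_inv hp] at h
  exact h.symm

theorem trans (hf : IsTransition n π f) (hg : IsTransition n π g) :
    IsTransition n π (f ≫ₕ g) := by
  refine ⟨?_, ?_, fun p hp => ?_⟩
  · rw [OpenPartialHomeomorph.trans_source]
    exact hg.smooth.comp (hf.smooth.mono inter_subset_left) (fun _ h => h.2)
  · rw [OpenPartialHomeomorph.trans_target]
    exact ContMDiffOn.comp (g := f.symm) (f := g.symm) (t := f.target) hf.smooth_symm
      (hg.smooth_symm.mono inter_subset_left) (fun _ h => h.2)
  · rw [OpenPartialHomeomorph.trans_source] at hp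
    exact (hg.comp_eq _ hp.2).trans (hf.comp_eq _ hp.1)

theorem restr (hf : IsTransition n π f) {s : Set M} (hs : IsOpen s) :
    IsTransition n π (f.restrOpen s hs) := by
  refine ⟨hf.smooth.mono inter_subset_left, hf.smooth_symm.mono ?_, fun p hp => ?_⟩
  · intro y hy
    have h2 := (f.restrOpen s hs).map_target hy
    rw [OpenPartialHomeomorph.restrOpen_source] at h2
    have h3 := f.map_source h2.1
    have h4 : f ((f.restrOpen s hs).symm y) = y := (f.restrOpen s hs).right_inv hy
    rwa [h4] at h3
  · exact hf.comp_eq p hp.1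

end IsTransition

variable (n) in
/-- A transition together with a point of its domain. -/
structure PointedTransition (π : M → X) where
  map : OpenPartialHomeomorph M M
  isTransition : IsTransition n π map
  pt : M
  pt_mem : pt ∈ map.source

variable (n) in
/-- Two pointed transitions have the same germ if they have the same base point and agree near
it. -/
def germSetoid (π : M → X) : Setoid (PointedTransition n π) where
  r a b := a.pt = b.pt ∧ a.map =ᶠ[𝓝 a.pt] b.map
  iseqv :=
    { refl := fun _ => ⟨rfl, Filter.EventuallyEq.rfl⟩
      symm := fun ⟨h, h'⟩ => ⟨h.symm, h ▸ h'.symm⟩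
      trans := fun ⟨h, h'⟩ ⟨k, k'⟩ => ⟨h.trans k, h'.trans (h ▸ k')⟩ }

variable (n) in
/-- The set of germs `[f]_p` of transitions `f` at points `p` of their domains. -/
def TransitionGerm (π : M → X) : Type u :=
  Quotient (germSetoid n π)

namespace TransitionGerm

variable {π : M → X}

/-- The germ `[f]_p`. -/
def mk (f : OpenPartialHomeomorph M M) (hf : IsTransition n π f) (p : M) (hp : p ∈ f.source) :
    TransitionGerm n π :=
  Quotient.mk (germSetoid n π) ⟨f, hf, p, hp⟩

theorem ind {P : TransitionGerm n π → Prop} (h : ∀ f hf p hp, P (mk f hf p hp)) (g) : P g :=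
  Quotient.ind (fun a => h a.map a.isTransition a.pt a.pt_mem) g

theorem mk_eq_mk {f g : OpenPartialHomeomorph M M} {hf : IsTransition n π f}
    {hg : IsTransition n π g} {p q : M} {hp : p ∈ f.source} {hq : q ∈ g.source} :
    mk f hf p hp = mk g hg q hq ↔ p = q ∧ f =ᶠ[𝓝 p] g :=
  Quotient.eq (r := germSetoid n π)

/-- `s([f]_p) = p`. -/
def src : TransitionGerm n π → M :=
  Quotient.lift (fun a => a.pt) (fun _ _ h => h.1)

/-- `t([f]_p) = f(p)`. -/
def tgt : TransitionGerm n π → M :=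
  Quotient.lift (fun a => a.map a.pt) (by
    rintro a b ⟨h, h'⟩
    rw [h'.eq_of_nhds, h])

@[simp] theorem src_mk (f : OpenPartialHomeomorph M M) (hf : IsTransition n π f) (p : M)
    (hp : p ∈ f.source) : src (mk f hf p hp) = p := rfl

@[simp] theorem tgt_mk (f : OpenPartialHomeomorph M M) (hf : IsTransition n π f) (p : M)
    (hp : p ∈ f.source) : tgt (mk f hf p hp) = f p := rfl

/-- `1_p = [id]_p`. -/
def unit (p : M) : TransitionGerm n π :=
  mk (OpenPartialHomeomorph.refl M) IsTransition.refl p (mem_univ p)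

theorem symm_eventuallyEq {f g : OpenPartialHomeomorph M M} {p : M} (hf : p ∈ f.source)
    (hg : p ∈ g.source) (h : f =ᶠ[𝓝 p] g) : f.symm =ᶠ[𝓝 (f p)] g.symm := by
  have h1 : Filter.Tendsto f.symm (𝓝 (f p)) (𝓝 p) := by
    have := f.continuousAt_symm (f.map_source hf)
    rwa [ContinuousAt, f.left_inv hf] at this
  filter_upwards [h1.eventually h, h1.eventually (g.open_source.mem_nhds hg),
    f.open_target.mem_nhds (f.map_source hf)] with y hy hy' hy''
  have h2 : g (f.symm y) = y := by rw [← hy, f.right_inv hy'']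
  have h3 := g.left_inv hy'
  rw [h2] at h3
  exact h3.symm

/-- `[f]_p⁻¹ = [f⁻¹]_{f(p)}`. -/
def inv : TransitionGerm n π → TransitionGerm n π :=
  Quotient.lift (fun a => mk a.map.symm a.isTransition.symm (a.map a.pt)
    (a.map.map_source a.pt_mem)) (by
    rintro ⟨f, hf, p, hp⟩ ⟨g, hg, q, hq⟩ ⟨h, h'⟩
    obtain rfl : p = q := h
    exact mk_eq_mk.2 ⟨h'.eq_of_nhds, symm_eventuallyEq hp hq h'⟩)

@[simp] theorem inv_mk (f : OpenPartialHomeomorph M M) (hf : IsTransition n π f) (p : M)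
    (hp : p ∈ f.source) :
    inv (mk f hf p hp) = mk f.symm hf.symm (f p) (f.map_source hp) := rfl

open Classical in
/-- `[g]_{f(p)} [f]_p = [g ∘ f]_p`, with the value `1_p` for non-composable germs. -/
noncomputable def comp : TransitionGerm n π → TransitionGerm n π → TransitionGerm n π :=
  Quotient.lift₂
    (fun b a => if h : a.map a.pt = b.pt then
      mk (a.map ≫ₕ b.map) (a.isTransition.trans b.isTransition) a.pt
        (by rw [OpenPartialHomeomorph.trans_source]; exact ⟨a.pt_mem, by
          rw [mem_preimage, h]; exact b.pt_mem⟩)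
      else unit a.pt) (by
    rintro ⟨g, hg, q, hq⟩ ⟨f, hf, p, hp⟩ ⟨g', hg', q', hq'⟩ ⟨f', hf', p', hp'⟩ ⟨h1, h2⟩ ⟨h3, h4⟩
    obtain rfl : q = q' := h1
    obtain rfl : p = p' := h3
    have h2 : g =ᶠ[𝓝 q] g' := h2
    have h4 : f =ᶠ[𝓝 p] f' := h4
    have h5 : f p = f' p := h4.eq_of_nhds
    by_cases h : f p = q
    · have h' : f' p = q := h5 ▸ h
      simp only [h, h', dite_true]
      refine mk_eq_mk.2 ⟨rfl, ?_⟩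
      have h6 : Filter.Tendsto f (𝓝 p) (𝓝 q) := h ▸ f.continuousAt hp
      filter_upwards [h4, h6.eventually h2] with x hx hx'
      rw [OpenPartialHomeomorph.trans_apply, OpenPartialHomeomorph.trans_apply, hx', hx]
    · have h' : ¬ f' p = q := h5 ▸ h
      simp only [h, h', dite_false])

theorem comp_mk' {g f : OpenPartialHomeomorph M M} {hg : IsTransition n π g}
    {hf : IsTransition n π f} {p q : M} {hp : p ∈ f.source} {hq : q ∈ g.source} (h : f p = q) :
    comp (mk g hg q hq) (mk f hf p hp) =
      mk (f ≫ₕ g) (hf.trans hg) p (by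
        rw [OpenPartialHomeomorph.trans_source]; exact ⟨hp, by rwa [mem_preimage, h]⟩) :=
  dif_pos h

theorem comp_mk (g f : OpenPartialHomeomorph M M) (hg : IsTransition n π g)
    (hf : IsTransition n π f) (p : M) (hp : p ∈ f.source) (hq : f p ∈ g.source) :
    comp (mk g hg (f p) hq) (mk f hf p hp) =
      mk (f ≫ₕ g) (hf.trans hg) p (by rw [OpenPartialHomeomorph.trans_source]; exact ⟨hp, hq⟩) :=
  comp_mk' rfl

/-- The set of germs of `f` at all points of its domain. -/
def germSet (π : M → X) (f : OpenPartialHomeomorph M M) (hf : IsTransition n π f) :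
    Set (TransitionGerm n π) :=
  {g | ∃ p hp, g = mk f hf p hp}

theorem mk_mem_germSet {f g : OpenPartialHomeomorph M M} {hf : IsTransition n π f}
    {hg : IsTransition n π g} {p : M} {hp : p ∈ f.source} :
    mk f hf p hp ∈ germSet π g hg ↔ p ∈ g.source ∧ f =ᶠ[𝓝 p] g := by
  constructor
  · rintro ⟨q, hq, h⟩
    obtain ⟨rfl, h'⟩ := mk_eq_mk.1 h
    exact ⟨hq, h'⟩
  · rintro ⟨h, h'⟩
    exact ⟨p, h, mk_eq_mk.2 ⟨rfl, h'⟩⟩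

/-- The topology on germs, generated by the sets of germs of a fixed transition. -/
instance : TopologicalSpace (TransitionGerm n π) :=
  TopologicalSpace.generateFrom {s | ∃ f hf, s = germSet π f hf}

theorem isOpen_germSet (f : OpenPartialHomeomorph M M) (hf : IsTransition n π f) :
    IsOpen (germSet π f hf) :=
  TopologicalSpace.isOpen_generateFrom_of_mem ⟨f, hf, rfl⟩

theorem continuous_src : Continuous (src : TransitionGerm n π → M) := by
  refine continuous_def.2 fun s hs => isOpen_iff_forall_mem_open.2 (ind fun f hf p hp h => ?_)
  refine ⟨germSet π (f.restrOpen s hs) (hf.restr hs), ?_, isOpen_germSet _ _, ?_⟩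
  · rintro _ ⟨q, hq, rfl⟩
    exact hq.2
  · exact mk_mem_germSet.2 ⟨⟨hp, h⟩, Filter.EventuallyEq.rfl⟩

open Classical in
/-- The section `p ↦ [f]_p` over the domain of `f` (continued by the units). -/
noncomputable def sec (f : OpenPartialHomeomorph M M) (hf : IsTransition n π f) (p : M) :
    TransitionGerm n π :=
  if hp : p ∈ f.source then mk f hf p hp else unit p

theorem sec_eq {f : OpenPartialHomeomorph M M} {hf : IsTransition n π f} {p : M}
    (hp : p ∈ f.source) : sec f hf p = mk f hf p hp := dif_pos hp

@[simp] theorem src_sec (f : OpenPartialHomeomorph M M) (hf : IsTransition n π f) (p : M) :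
    src (sec f hf p) = p := by
  unfold sec
  split_ifs <;> rfl

/-- The bijection between germs of `f` and the domain of `f`, as a partial homeomorphism. -/
noncomputable def germChart (f : OpenPartialHomeomorph M M) (hf : IsTransition n π f) :
    OpenPartialHomeomorph (TransitionGerm n π) M where
  toFun := src
  invFun := sec f hf
  source := germSet π f hf
  target := f.source
  map_source' := by rintro _ ⟨p, hp, rfl⟩; exact hp
  map_target' p hp := ⟨p, hp, sec_eq hp⟩
  left_inv' := by rintro _ ⟨p, hp, rfl⟩; exact sec_eq hp
  right_inv' p _ := src_sec f hf p
  open_source := isOpen_germSet f hf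
  open_target := f.open_source
  continuousOn_toFun := continuous_src.continuousOn
  continuousOn_invFun := by
    refine continuousOn_to_generateFrom_iff.2 ?_
    rintro p hp _ ⟨g, hg, rfl⟩ h
    rw [sec_eq hp, mk_mem_germSet] at h
    refine mem_nhdsWithin_of_mem_nhds ?_
    filter_upwards [f.open_source.mem_nhds hp, g.open_source.mem_nhds h.1,
      h.2.eventuallyEq_nhds] with q hq hq' hq''
    rw [mem_preimage, sec_eq hq]
    exact mk_mem_germSet.2 ⟨hq', hq''⟩

/-- The manifold structure for which all bijections `p ↦ [f]_p` are diffeomorphisms. -/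
noncomputable instance : ChartedSpace (EuclideanSpace ℝ (Fin n)) (TransitionGerm n π) where
  atlas := {e | ∃ f hf, ∃ φ ∈ atlas (EuclideanSpace ℝ (Fin n)) M, e = germChart f hf ≫ₕ φ}
  chartAt g := germChart (Quotient.out g).map (Quotient.out g).isTransition ≫ₕ
    chartAt (EuclideanSpace ℝ (Fin n)) (src g)
  mem_chart_source g := by
    rw [OpenPartialHomeomorph.trans_source]
    refine ⟨⟨_, (Quotient.out g).pt_mem, (Quotient.out_eq g).symm⟩, mem_chart_source _ _⟩
  chart_mem_atlas g := ⟨_, _, _, chart_mem_atlas _ _, rfl⟩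

variable [IsManifold (𝓡 n) ∞ M]

instance : IsManifold (𝓡 n) ∞ (TransitionGerm n π) := by
  refine isManifold_of_contDiffOn _ _ _ ?_
  rintro _ _ ⟨f, hf, φ, hφ, rfl⟩ ⟨g, hg, ψ, hψ, rfl⟩
  have h := (contDiffGroupoid ∞ (𝓡 n)).compatible hφ hψ
  rw [contDiffGroupoid, mem_groupoid_of_pregroupoid] at h
  have h1 : ContDiffOn ℝ ∞ (φ.symm ≫ₕ ψ) (φ.symm ≫ₕ ψ).source := by
    simpa [contDiffPregroupoid] using h.1
  have h2 : ∀ x, ((germChart f hf ≫ₕ φ).symm ≫ₕ germChart g hg ≫ₕ ψ) x = (φ.symm ≫ₕ ψ) x := by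
    intro x
    change ψ (src (sec f hf (φ.symm x))) = ψ (φ.symm x)
    rw [src_sec]
  simp only [modelWithCornersSelf_coe, modelWithCornersSelf_coe_symm, Function.comp_id,
    Function.id_comp, preimage_id_eq, id_eq, range_id, inter_univ]
  refine (h1.congr fun x _ => h2 x).mono ?_
  intro x hx
  simp only [OpenPartialHomeomorph.trans_source, OpenPartialHomeomorph.symm_source,
    OpenPartialHomeomorph.trans_target, mem_inter_iff, mem_preimage] at hx ⊢
  refine ⟨hx.1.1, ?_⟩
  have h3 := hx.2.2
  have h4 : (germChart g hg) ((germChart f hf ≫ₕ φ).symm x) = φ.symm x := src_sec _ _ _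
  rwa [h4] at h3

theorem contMDiffOn_src (f : OpenPartialHomeomorph M M) (hf : IsTransition n π f) :
    ContMDiffOn (𝓡 n) (𝓡 n) ∞ (src : TransitionGerm n π → M) (germSet π f hf) := by
  rintro _ ⟨p, hp, rfl⟩
  refine ContMDiffAt.contMDiffWithinAt ?_
  have he : germChart f hf ≫ₕ chartAt (EuclideanSpace ℝ (Fin n)) p ∈
      IsManifold.maximalAtlas (𝓡 n) ∞ (TransitionGerm n π) :=
    IsManifold.subset_maximalAtlas ⟨f, hf, _, chart_mem_atlas _ _, rfl⟩
  have hm : mk f hf p hp ∈ (germChart f hf ≫ₕ chartAt (EuclideanSpace ℝ (Fin n)) p).source := by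
    rw [OpenPartialHomeomorph.trans_source]
    exact ⟨⟨p, hp, rfl⟩, mem_chart_source _ _⟩
  have h1 := contMDiffAt_of_mem_maximalAtlas he hm
  have h2 := (contMDiffOn_chart_symm (I := 𝓡 n) (n := ∞) (x := p)).contMDiffAt
    ((chartAt (EuclideanSpace ℝ (Fin n)) p).open_target.mem_nhds (mem_chart_target _ p))
  refine (ContMDiffAt.comp (mk f hf p hp) (by exact h2) h1).congr_of_eventuallyEq ?_
  filter_upwards [(germChart f hf ≫ₕ chartAt (EuclideanSpace ℝ (Fin n)) p).open_source.mem_nhds hm]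
    with y hy
  rw [OpenPartialHomeomorph.trans_source] at hy
  exact ((chartAt (EuclideanSpace ℝ (Fin n)) p).left_inv hy.2).symm

theorem contMDiffOn_sec (f : OpenPartialHomeomorph M M) (hf : IsTransition n π f) :
    ContMDiffOn (𝓡 n) (𝓡 n) ∞ (sec f hf) f.source := by
  intro p hp
  refine ContMDiffAt.contMDiffWithinAt ?_
  have he : germChart f hf ≫ₕ chartAt (EuclideanSpace ℝ (Fin n)) p ∈
      IsManifold.maximalAtlas (𝓡 n) ∞ (TransitionGerm n π) :=
    IsManifold.subset_maximalAtlas ⟨f, hf, _, chart_mem_atlas _ _, rfl⟩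
  have hl := (chartAt (EuclideanSpace ℝ (Fin n)) p).left_inv (mem_chart_source _ p)
  have hm : chartAt (EuclideanSpace ℝ (Fin n)) p p ∈
      (germChart f hf ≫ₕ chartAt (EuclideanSpace ℝ (Fin n)) p).target := by
    rw [OpenPartialHomeomorph.trans_target]
    refine ⟨mem_chart_target _ p, ?_⟩
    rw [mem_preimage, hl]
    exact hp
  have h1 := contMDiffAt_symm_of_mem_maximalAtlas he hm
  have h2 := (contMDiffOn_chart (I := 𝓡 n) (n := ∞) (x := p)).contMDiffAt
    ((chartAt (EuclideanSpace ℝ (Fin n)) p).open_source.mem_nhds (mem_chart_source _ p))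
  refine (ContMDiffAt.comp p (by exact h1) h2).congr_of_eventuallyEq ?_
  filter_upwards [(chartAt (EuclideanSpace ℝ (Fin n)) p).open_source.mem_nhds
    (mem_chart_source _ p)] with y hy
  change sec f hf y = sec f hf ((chartAt (EuclideanSpace ℝ (Fin n)) p).symm _)
  rw [(chartAt (EuclideanSpace ℝ (Fin n)) p).left_inv hy]

theorem isLocalDiffeomorph_src :
    IsLocalDiffeomorph (𝓡 n) (𝓡 n) ∞ (src : TransitionGerm n π → M) := by
  refine ind fun f hf p hp => ?_
  exact ⟨⟨(germChart f hf).toPartialEquiv, (germChart f hf).open_source,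
    (germChart f hf).open_target, contMDiffOn_src f hf, contMDiffOn_sec f hf⟩,
    ⟨p, hp, rfl⟩, fun _ _ => rfl⟩

theorem isLocalDiffeomorph_tgt :
    IsLocalDiffeomorph (𝓡 n) (𝓡 n) ∞ (tgt : TransitionGerm n π → M) := by
  refine ind fun f hf p hp => ?_
  have h : (germChart f hf ≫ₕ f).source = germSet π f hf := by
    rw [OpenPartialHomeomorph.trans_source]
    refine inter_eq_left.2 ?_
    rintro _ ⟨q, hq, rfl⟩
    exact hq
  have hm : mk f hf p hp ∈ (germChart f hf ≫ₕ f).source := by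
    rw [h]
    exact ⟨p, hp, rfl⟩
  refine ⟨⟨(germChart f hf ≫ₕ f).toPartialEquiv, (germChart f hf ≫ₕ f).open_source,
    (germChart f hf ≫ₕ f).open_target, ?_, ?_⟩, hm, ?_⟩
  · change ContMDiffOn _ _ _ (germChart f hf ≫ₕ f) (germChart f hf ≫ₕ f).source
    rw [h]
    refine hf.smooth.comp (contMDiffOn_src f hf) ?_
    rintro _ ⟨q, hq, rfl⟩
    exact hq
  · change ContMDiffOn _ _ _ (germChart f hf ≫ₕ f).symm (germChart f hf ≫ₕ f).target
    rw [OpenPartialHomeomorph.trans_target]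
    exact ContMDiffOn.comp (g := sec f hf) (f := f.symm) (t := f.source) (contMDiffOn_sec f hf)
      (hf.smooth_symm.mono inter_subset_left) (fun _ h => h.2)
  · change EqOn tgt (germChart f hf ≫ₕ f) (germChart f hf ≫ₕ f).source
    rw [h]
    rintro _ ⟨q, hq, rfl⟩
    rfl

theorem contMDiff_unit : ContMDiff (𝓡 n) (𝓡 n) ∞ (unit : M → TransitionGerm n π) := by
  have h := contMDiffOn_sec (n := n) (π := π) (OpenPartialHomeomorph.refl M) IsTransition.refl
  have h' : sec (n := n) (π := π) (OpenPartialHomeomorph.refl M) IsTransition.refl = unit :=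
    funext fun p => sec_eq (mem_univ p)
  rw [h'] at h
  exact contMDiffOn_univ.1 h

theorem contMDiff_inv :
    ContMDiff (𝓡 n) (𝓡 n) ∞ (inv : TransitionGerm n π → TransitionGerm n π) := by
  refine ind fun f hf p hp => ?_
  have h : ContMDiffOn (𝓡 n) (𝓡 n) ∞ (sec f.symm hf.symm ∘ tgt) (germSet π f hf) := by
    refine (contMDiffOn_sec f.symm hf.symm).comp isLocalDiffeomorph_tgt.contMDiff.contMDiffOn ?_
    rintro _ ⟨q, hq, rfl⟩
    exact f.map_source hq
  have h' := (h _ ⟨p, hp, rfl⟩).contMDiffAt ((isOpen_germSet f hf).mem_nhds ⟨p, hp, rfl⟩)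
  refine h'.congr_of_eventuallyEq ?_
  filter_upwards [(isOpen_germSet f hf).mem_nhds ⟨p, hp, rfl⟩]
  rintro _ ⟨q, hq, rfl⟩
  exact (sec_eq (f.map_source hq)).symm

theorem contMDiffOn_comp : ContMDiffOn ((𝓡 n).prod (𝓡 n)) (𝓡 n) ∞
    (fun x : TransitionGerm n π × TransitionGerm n π => comp x.1 x.2)
    {x | src x.1 = tgt x.2} := by
  suffices H : ∀ b a : TransitionGerm n π, src b = tgt a →
      ContMDiffWithinAt ((𝓡 n).prod (𝓡 n)) (𝓡 n) ∞
        (fun x : TransitionGerm n π × TransitionGerm n π => comp x.1 x.2)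
        {x | src x.1 = tgt x.2} (b, a) from fun x hx => H x.1 x.2 hx
  refine ind fun g hg q hq => ind fun f hf p hp => ?_
  intro (h : q = f p)
  subst h
  have hp' : p ∈ (f ≫ₕ g).source := by
    rw [OpenPartialHomeomorph.trans_source]; exact ⟨hp, hq⟩
  have h1 : ContMDiffAt (𝓡 n) (𝓡 n) ∞ (sec (f ≫ₕ g) (hf.trans hg)) p :=
    (contMDiffOn_sec _ _ p hp').contMDiffAt ((f ≫ₕ g).open_source.mem_nhds hp')
  have h2 : ContMDiffAt ((𝓡 n).prod (𝓡 n)) (𝓡 n) ∞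
      (fun x : TransitionGerm n π × TransitionGerm n π => src x.2)
      (mk g hg (f p) hq, mk f hf p hp) :=
    (isLocalDiffeomorph_src.contMDiff (mk f hf p hp)).comp
      (mk g hg (f p) hq, mk f hf p hp) contMDiffAt_snd
  have h3 := ContMDiffAt.comp (mk g hg (f p) hq, mk f hf p hp)
    (g := sec (f ≫ₕ g) (hf.trans hg)) (by exact h1) h2
  refine h3.contMDiffWithinAt.congr_of_eventuallyEq ?_ ?_
  · have hn : germSet π g hg ×ˢ germSet π f hf ∈ 𝓝 (mk g hg (f p) hq, mk f hf p hp) :=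
      ((isOpen_germSet g hg).prod (isOpen_germSet f hf)).mem_nhds ⟨⟨_, hq, rfl⟩, ⟨_, hp, rfl⟩⟩
    filter_upwards [mem_nhdsWithin_of_mem_nhds hn, self_mem_nhdsWithin]
    rintro ⟨_, _⟩ ⟨⟨q', hq', rfl⟩, ⟨p', hp', rfl⟩⟩ (h : q' = f p')
    subst h
    exact (comp_mk g f hg hf p' hp' hq').trans (sec_eq _).symm
  · exact (comp_mk g f hg hf p hp hq).trans (sec_eq _).symm

end TransitionGerm

/-- The Lie groupoid of germs of transitions over `X`. -/
noncomputable def transitionGroupoid [IsManifold (𝓡 n) ∞ M] [T2Space M]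
    [SecondCountableTopology M] (π : M → X) : LieGroupoid.{u, u} n n where
  Obj := M
  Arr := TransitionGerm n π
  src := TransitionGerm.src
  tgt := TransitionGerm.tgt
  mul g h _ := TransitionGerm.comp g h
  unit := TransitionGerm.unit
  inv := TransitionGerm.inv
  src_submersion := isSubmersion_of_isLocalDiffeomorph TransitionGerm.isLocalDiffeomorph_src
  tgt_submersion := isSubmersion_of_isLocalDiffeomorph TransitionGerm.isLocalDiffeomorph_tgt
  smooth_mul := TransitionGerm.contMDiffOn_comp.congr fun _ hx => dif_pos hx
  smooth_unit := TransitionGerm.contMDiff_unit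
  smooth_inv := TransitionGerm.contMDiff_inv
  src_mul := by
    refine TransitionGerm.ind fun g hg q hq => TransitionGerm.ind fun f hf p hp => ?_
    intro (h : q = f p)
    subst h
    exact (congrArg TransitionGerm.src (TransitionGerm.comp_mk' rfl)).trans rfl
  tgt_mul := by
    refine TransitionGerm.ind fun g hg q hq => TransitionGerm.ind fun f hf p hp => ?_
    intro (h : q = f p)
    subst h
    exact (congrArg TransitionGerm.tgt (TransitionGerm.comp_mk' rfl)).trans rfl
  mul_assoc := by
    refine TransitionGerm.ind fun g hg q hq => TransitionGerm.ind fun f hf p hp =>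
      TransitionGerm.ind fun e he r hr => ?_
    intro (h : q = f p) (h' : p = e r)
    subst h'
    subst h
    refine (congrArg (fun z => TransitionGerm.comp z _) (TransitionGerm.comp_mk' rfl)).trans ?_
    refine Eq.trans ?_
      (congrArg (fun z => TransitionGerm.comp _ z) (TransitionGerm.comp_mk' rfl)).symm
    have hm : r ∈ (e ≫ₕ f).source := by
      rw [OpenPartialHomeomorph.trans_source]
      exact ⟨hr, hp⟩
    have hm' : r ∈ ((e ≫ₕ f) ≫ₕ g).source := by
      rw [OpenPartialHomeomorph.trans_source]
      exact ⟨hm, hq⟩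
    have hm'' : r ∈ (e ≫ₕ (f ≫ₕ g)).source := by
      rwa [← OpenPartialHomeomorph.trans_assoc]
    have h1 : TransitionGerm.comp (TransitionGerm.mk g hg (f (e r)) hq)
        (TransitionGerm.mk (e ≫ₕ f) (he.trans hf) r hm) =
        TransitionGerm.mk ((e ≫ₕ f) ≫ₕ g) ((he.trans hf).trans hg) r hm' :=
      TransitionGerm.comp_mk' rfl
    have h2 : TransitionGerm.mk (e ≫ₕ (f ≫ₕ g)) (he.trans (hf.trans hg)) r hm'' =
        TransitionGerm.mk ((e ≫ₕ f) ≫ₕ g) ((he.trans hf).trans hg) r hm' :=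
      TransitionGerm.mk_eq_mk.2 ⟨rfl, Filter.EventuallyEq.rfl⟩
    exact (TransitionGerm.comp_mk' rfl).trans (h2.trans h1.symm)
  src_unit _ := rfl
  tgt_unit _ := rfl
  mul_unit := by
    refine TransitionGerm.ind fun f hf p hp => ?_
    exact (TransitionGerm.comp_mk f (OpenPartialHomeomorph.refl M) hf IsTransition.refl p
      (mem_univ _) hp).trans (TransitionGerm.mk_eq_mk.2 ⟨rfl, Filter.EventuallyEq.rfl⟩)
  unit_mul := by
    refine TransitionGerm.ind fun f hf p hp => ?_
    exact (TransitionGerm.comp_mk (OpenPartialHomeomorph.refl M) f IsTransition.refl hf p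
      hp (mem_univ _)).trans (TransitionGerm.mk_eq_mk.2 ⟨rfl, Filter.EventuallyEq.rfl⟩)
  src_inv := TransitionGerm.ind fun f hf p hp => rfl
  tgt_inv := TransitionGerm.ind fun f hf p hp => f.left_inv hp
  mul_inv := by
    refine TransitionGerm.ind fun f hf p hp => ?_
    refine (TransitionGerm.comp_mk' (f.left_inv hp)).trans (TransitionGerm.mk_eq_mk.2 ⟨rfl, ?_⟩)
    filter_upwards [f.open_target.mem_nhds (f.map_source hp)] with y hy
    exact f.right_inv hy
  inv_mul := by
    refine TransitionGerm.ind fun f hf p hp => ?_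
    refine (TransitionGerm.comp_mk' rfl).trans (TransitionGerm.mk_eq_mk.2 ⟨rfl, ?_⟩)
    filter_upwards [f.open_source.mem_nhds hp] with y hy
    exact f.left_inv hy

end Germs

/-! ### Disjoint unions of manifolds -/

section Sigma

variable {n : ℕ} {ι : Type w} {M : ι → Type u} [∀ i, TopologicalSpace (M i)]
  [∀ i, ChartedSpace (EuclideanSpace ℝ (Fin n)) (M i)]

/-- The charts of a disjoint union are the charts of its summands. -/
noncomputable instance sigmaChartedSpace :
    ChartedSpace (EuclideanSpace ℝ (Fin n)) (Σ i, M i) where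
  atlas := {e | ∃ i, ∃ φ ∈ atlas (EuclideanSpace ℝ (Fin n)) (M i),
    e = φ.lift_openEmbedding (IsOpenEmbedding.sigmaMk (i := i))}
  chartAt p := (chartAt (EuclideanSpace ℝ (Fin n)) p.2).lift_openEmbedding
    (IsOpenEmbedding.sigmaMk (i := p.1))
  mem_chart_source p := ⟨p.2, mem_chart_source _ p.2, rfl⟩
  chart_mem_atlas p := ⟨p.1, _, chart_mem_atlas _ p.2, rfl⟩

instance sigmaIsManifold [∀ i, IsManifold (𝓡 n) ∞ (M i)] : IsManifold (𝓡 n) ∞ (Σ i, M i) where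
  compatible := by
    rintro _ _ ⟨i, φ, hφ, rfl⟩ ⟨j, ψ, hψ, rfl⟩
    by_cases h : i = j
    · subst h
      rw [φ.lift_openEmbedding_trans ψ]
      exact (contDiffGroupoid ∞ (𝓡 n)).compatible hφ hψ
    · refine ContDiffGroupoid.mem_of_source_eq_empty _ (eq_empty_of_forall_notMem ?_)
      rintro x ⟨_, y, _, hy⟩
      exact h (congrArg Sigma.fst hy).symm

end Sigma

/-! ### Orbifold charts and atlases -/

/-- The map `M / Γ → π(M)` induced by a `Γ`-invariant map `π`. -/
def orbitSpaceMap {Γ : Type*} {M : Type*} {X : Type*} [Group Γ] [MulAction Γ M] (π : M → X)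
    (h : ∀ (γ : Γ) (p : M), π (γ • p) = π p) : Quotient (MulAction.orbitRel Γ M) → range π :=
  Quotient.lift (rangeFactorization π) (by
    rintro p q ⟨γ, rfl⟩
    exact Subtype.ext (h γ q))

/-- An `n`-dimensional orbifold chart `(U, Ũ/Γ, π)` on `X`: the manifold `Ũ` is `Dom`, the finite
group `Γ` is `Grp`, the projection `π` is `proj` and `U` is the range of `π`. -/
structure OrbifoldChart (n : ℕ) (X : Type v) [TopologicalSpace X] where
  Dom : Type u
  [topDom : TopologicalSpace Dom]
  [chartedDom : ChartedSpace (EuclideanSpace ℝ (Fin n)) Dom]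
  [manifoldDom : IsManifold (𝓡 n) ∞ Dom]
  [t2Dom : T2Space Dom]
  [secondCountableDom : SecondCountableTopology Dom]
  [connectedDom : ConnectedSpace Dom]
  Grp : Type u
  [group : Group Grp]
  [finite : Finite Grp]
  [action : MulAction Grp Dom]
  [faithful : FaithfulSMul Grp Dom]
  smooth_smul : ∀ γ : Grp, ContMDiff (𝓡 n) (𝓡 n) ∞ (fun p : Dom => γ • p)
  proj : Dom → X
  continuous_proj : Continuous proj
  proj_smul : ∀ (γ : Grp) (p : Dom), proj (γ • p) = proj p
  isOpen_range : IsOpen (range proj)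
  isHomeomorph : IsHomeomorph (orbitSpaceMap proj proj_smul)

namespace OrbifoldChart

attribute [instance] topDom chartedDom manifoldDom t2Dom secondCountableDom connectedDom group
  finite action faithful

variable {n : ℕ} {X : Type v} [TopologicalSpace X]

/-- The open subset `U ⊆ X` of a chart. -/
def support (φ : OrbifoldChart.{u} n X) : Set X := range φ.proj

/-- An injection between charts is a smooth embedding over `X`. -/
structure IsInjection (φ ψ : OrbifoldChart.{u} n X) (l : φ.Dom → ψ.Dom) : Prop where
  embedding : IsSmoothEmbedding (𝓡 n) (𝓡 n) ∞ l
  proj_comp : ∀ p, ψ.proj (l p) = φ.proj p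

/-- Two charts are compatible if around each common point there is a chart with injections into
both. -/
def Compatible (φ ψ : OrbifoldChart.{u} n X) : Prop :=
  ∀ x ∈ φ.support ∩ ψ.support, ∃ χ : OrbifoldChart.{u} n X,
    x ∈ χ.support ∧ χ.support ⊆ φ.support ∩ ψ.support ∧
    (∃ l, χ.IsInjection φ l) ∧ ∃ l, χ.IsInjection ψ l

end OrbifoldChart

section Orbifolds

variable {n : ℕ} {X : Type v} [TopologicalSpace X]

/-- A family of orbifold charts is an atlas if the charts are pairwise compatible and cover `X`. -/
structure IsOrbifoldAtlas {ι : Type w} (𝒰 : ι → OrbifoldChart.{u} n X) : Prop where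
  compatible : ∀ i j, (𝒰 i).Compatible (𝒰 j)
  covers : ⋃ i, (𝒰 i).support = univ

/-- A set of orbifold charts is a maximal atlas if it is an atlas and contains every chart which is
compatible with all of its members. -/
structure IsMaximalOrbifoldAtlas (𝒜 : Set (OrbifoldChart.{u} n X)) : Prop where
  isAtlas : IsOrbifoldAtlas (fun φ : 𝒜 => φ.1)
  maximal : ∀ φ : OrbifoldChart.{u} n X, (∀ ψ ∈ 𝒜, φ.Compatible ψ) → φ ∈ 𝒜

/-- The germ groupoid `𝒢(𝒰)` of a countable family of orbifold charts: its space of objects is the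
disjoint union of the manifolds `Ũᵢ`, and its arrows are the germs of transitions over `X`. (The
construction uses neither the compatibility of the charts nor the groups `Γᵢ`.) -/
noncomputable def germGroupoid {ι : Type w} [Countable ι] (𝒰 : ι → OrbifoldChart.{u} n X) :
    LieGroupoid.{max w u, max w u} n n :=
  transitionGroupoid (M := Σ i, (𝒰 i).Dom) (fun p => (𝒰 p.1).proj p.2)

/-- The map `ε : |𝒢(𝒰)| → X` which sends the orbit of `p` to `π(p)`. -/
noncomputable def orbitToSpace {ι : Type w} [Countable ι] (𝒰 : ι → OrbifoldChart.{u} n X) :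
    (germGroupoid 𝒰).OrbitSpace → X :=
  Quotient.lift (fun p : Σ i, (𝒰 i).Dom => (𝒰 p.1).proj p.2) (by
    rintro _ _ ⟨g, rfl, rfl⟩
    revert g
    exact TransitionGerm.ind fun f hf p hp => (hf.comp_eq p hp).symm)

end Orbifolds

/-! ### Submanifolds and group actions -/

/-- A `k`-dimensional (embedded) submanifold of an `n`-dimensional manifold `M`: a subset with a
manifold structure, inducing the subspace topology, for which the inclusion is a smooth
embedding. -/
structure EmbeddedSubmanifold (k n : ℕ) (M : Type u) [TopologicalSpace M]
    [ChartedSpace (EuclideanSpace ℝ (Fin n)) M] where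
  carrier : Set M
  [charted : ChartedSpace (EuclideanSpace ℝ (Fin k)) carrier]
  [manifold : IsManifold (𝓡 k) ∞ carrier]
  isSmoothEmbedding : IsSmoothEmbedding (𝓡 k) (𝓡 n) ∞ (Subtype.val : carrier → M)

attribute [instance] EmbeddedSubmanifold.charted EmbeddedSubmanifold.manifold

/-- For a group `G` acting on `M`, the condition which makes a submanifold `N` of `M` an
`L`-submanifold: `N` is `L`-invariant, and whenever `p` and `g p` lie in `N` there is `l ∈ L` with
`l p = g p`. -/
structure IsGroupInvariant {G : Type*} {M : Type*} [Group G] [MulAction G M] (L : Subgroup G)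
    (N : Set M) : Prop where
  smul_mem : ∀ l ∈ L, ∀ p ∈ N, l • p ∈ N
  exists_smul_eq : ∀ g : G, ∀ p ∈ N, g • p ∈ N → ∃ l ∈ L, l • p = g • p

namespace IsGroupInvariant

variable {G : Type u} {M : Type u} [Group G] [MulAction G M] {L : Subgroup G} {N : Set M}

/-- The restricted action of `L` on `N`. -/
abbrev action (h : IsGroupInvariant L N) : MulAction L N where
  smul l p := ⟨l.1 • p.1, h.smul_mem l.1 l.2 p.1 p.2⟩
  one_smul p := Subtype.ext (one_smul G p.1)
  mul_smul a b p := Subtype.ext (mul_smul a.1 b.1 p.1)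

/-- The kernel `K` of the action of `L` on `N`. -/
def kernel (h : IsGroupInvariant L N) : Subgroup L :=
  letI := h.action
  (MulAction.toPermHom L N).ker

instance (h : IsGroupInvariant L N) : h.kernel.Normal :=
  letI := h.action
  inferInstanceAs (MulAction.toPermHom L N).ker.Normal

/-- The effective action of `L ⧸ K` on `N`. -/
noncomputable abbrev effectiveAction (h : IsGroupInvariant L N) : MulAction (L ⧸ h.kernel) N :=
  letI := h.action
  MulAction.compHom N (QuotientGroup.kerLift (MulAction.toPermHom L N))

theorem effectiveAction_smul (h : IsGroupInvariant L N) (l : L) (p : N) :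
    letI := h.effectiveAction
    ((((l : L ⧸ h.kernel) • p : N)) : M) = l.1 • p.1 := rfl

theorem faithful (h : IsGroupInvariant L N) :
    letI := h.effectiveAction
    FaithfulSMul (L ⧸ h.kernel) N := by
  let := h.action
  let := h.effectiveAction
  exact ⟨fun {a b} hab =>
    QuotientGroup.kerLift_injective (MulAction.toPermHom L N) (Equiv.ext hab)⟩

end IsGroupInvariant

/-! ### Suborbifold covers -/

section Covers

variable {n : ℕ} {X : Type v} [TopologicalSpace X]

/-- A `k`-dimensional suborbifold cover `{Ṽⱼ}_{j ∈ J}` on `Y ⊆ X` with respect to a family of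
orbifold charts; `subgroup j` is a subgroup `Δⱼ` of `Γⱼ` for which `Ṽⱼ` is a `Δⱼ`-submanifold. -/
structure SuborbifoldCover (k : ℕ) {ι : Type w} (𝒰 : ι → OrbifoldChart.{u} n X) (Y : Set X) where
  J : Set ι
  V : ∀ j : J, EmbeddedSubmanifold k n (𝒰 j).Dom
  connected : ∀ j, IsConnected (V j).carrier
  subgroup : ∀ j : J, Subgroup (𝒰 j).Grp
  invariant : ∀ j, IsGroupInvariant (subgroup j) (V j).carrier
  isOpen_image : ∀ j : J, IsOpen (Subtype.val ⁻¹' ((𝒰 j).proj '' (V j).carrier) : Set Y)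
  covers : ⋃ j : J, (𝒰 j).proj '' (V j).carrier = Y

/-- A suborbifold cover is closed if each `Ṽⱼ` is closed in `Ũⱼ`. -/
structure ClosedSuborbifoldCover (k : ℕ) {ι : Type w} (𝒰 : ι → OrbifoldChart.{u} n X)
    (Y : Set X) extends SuborbifoldCover k 𝒰 Y where
  isClosed : ∀ j, IsClosed (V j).carrier

theorem OrbifoldChart.isClosedMap (φ : OrbifoldChart.{u} n X) :
    IsClosedMap (rangeFactorization φ.proj) := by
  have : ContinuousConstSMul φ.Grp φ.Dom := ⟨fun γ => (φ.smooth_smul γ).continuous⟩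
  have h : IsClosedMap (Quotient.mk (MulAction.orbitRel φ.Grp φ.Dom)) := by
    intro C hC
    rw [← isQuotientMap_quotient_mk'.isClosed_preimage]
    have : Quotient.mk (MulAction.orbitRel φ.Grp φ.Dom) ⁻¹'
        (Quotient.mk (MulAction.orbitRel φ.Grp φ.Dom) '' C) =
        ⋃ γ : φ.Grp, (fun p => γ • p) ⁻¹' C := by
      ext p
      simp only [mem_preimage, mem_image, mem_iUnion]
      constructor
      · rintro ⟨q, hq, hqp⟩
        obtain ⟨γ, rfl⟩ := Quotient.exact hqp
        exact ⟨γ, hq⟩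
      · rintro ⟨γ, hγ⟩
        exact ⟨γ • p, hγ, Quotient.sound ⟨γ, rfl⟩⟩
    exact this ▸ isClosed_iUnion_of_finite fun γ => hC.preimage (continuous_const_smul γ)
  exact φ.isHomeomorph.isClosedMap.comp h

theorem OrbifoldChart.exists_smul_eq (φ : OrbifoldChart.{u} n X) {p q : φ.Dom}
    (h : φ.proj p = φ.proj q) : ∃ γ : φ.Grp, γ • p = q := by
  have h' := φ.isHomeomorph.injective (a₁ := Quotient.mk _ q) (a₂ := Quotient.mk _ p)
    (Subtype.ext h.symm)
  exact Quotient.exact h'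

namespace ClosedSuborbifoldCover

variable {k : ℕ} {ι : Type w} {𝒰 : ι → OrbifoldChart.{u} n X} {Y : Set X}

theorem proj_mem (c : ClosedSuborbifoldCover k 𝒰 Y) (j : c.J) (p : (c.V j).carrier) :
    (𝒰 j).proj p.1 ∈ Y :=
  c.covers.subset (mem_iUnion.2 ⟨j, p.1, p.2, rfl⟩)

/-- The members `(Vⱼ, Ṽⱼ/(Δⱼ/Kⱼ), πⱼ|Ṽⱼ)` of the atlas on `Y` induced by a closed suborbifold cover,
where `Kⱼ` is the kernel of the action of `Δⱼ` on `Ṽⱼ`. -/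
noncomputable def inducedChart (c : ClosedSuborbifoldCover k 𝒰 Y) (j : c.J) :
    OrbifoldChart.{u} k Y :=
  letI := (c.invariant j).effectiveAction
  haveI := (c.invariant j).faithful
  haveI : ConnectedSpace (c.V j).carrier := isConnected_iff_connectedSpace.1 (c.connected j)
  have hinv : ∀ (γ : c.subgroup j ⧸ (c.invariant j).kernel) (p : (c.V j).carrier),
      (⟨(𝒰 j).proj (γ • p).1, c.proj_mem j _⟩ : Y) = ⟨(𝒰 j).proj p.1, c.proj_mem j p⟩ := by
    intro γ p
    induction γ using QuotientGroup.induction_on with | H l => ?_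
    exact Subtype.ext ((𝒰 j).proj_smul l.1 p.1)
  { Dom := (c.V j).carrier
    Grp := c.subgroup j ⧸ (c.invariant j).kernel
    smooth_smul := by
      intro γ
      induction γ using QuotientGroup.induction_on with | H l => ?_
      have h1 : ContMDiff (𝓡 k) (𝓡 n) ∞ (fun p : (c.V j).carrier => l.1 • p.1) :=
        ((𝒰 j).smooth_smul l.1).comp (c.V j).isSmoothEmbedding.contMDiff
      exact (ContMDiff.iff_comp_isImmersion (c.V j).isSmoothEmbedding.isImmersion).2
        ⟨(c.V j).isSmoothEmbedding.isEmbedding.continuous_iff.2 h1.continuous, h1⟩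
    proj := fun p => ⟨(𝒰 j).proj p.1, c.proj_mem j p⟩
    continuous_proj := ((𝒰 j).continuous_proj.comp continuous_subtype_val).subtype_mk _
    proj_smul := hinv
    isOpen_range := by
      convert c.isOpen_image j using 1
      ext y
      constructor
      · rintro ⟨p, rfl⟩
        exact ⟨p.1, p.2, rfl⟩
      · rintro ⟨p, hp, h⟩
        exact ⟨⟨p, hp⟩, Subtype.ext h⟩
    isHomeomorph := by
      rw [isHomeomorph_iff_continuous_isClosedMap_bijective]
      refine ⟨?_, ?_, ?_, ?_⟩
      · exact Continuous.quotient_lift ((((𝒰 j).continuous_proj.comp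
          continuous_subtype_val).subtype_mk _).subtype_mk _) _
      · intro C hC
        have h1 := hC.preimage continuous_quotient_mk'
        have h2 := (𝒰 j).isClosedMap _ ((c.isClosed j).isClosedEmbedding_subtypeVal.isClosedMap _ h1)
        obtain ⟨F, hF, hFC⟩ := isClosed_induced_iff.1 h2
        refine isClosed_induced_iff.2 ⟨Subtype.val ⁻¹' F, hF.preimage continuous_subtype_val, ?_⟩
        ext ⟨_, p, rfl⟩
        constructor
        · intro (hp : (𝒰 j).proj p.1 ∈ F)
          have h3 : rangeFactorization (𝒰 j).proj p.1 ∈ Subtype.val ⁻¹' F := hp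
          rw [hFC] at h3
          obtain ⟨_, ⟨q, hq, rfl⟩, h4⟩ := h3
          have h5 : (𝒰 j).proj q.1 = (𝒰 j).proj p.1 := congrArg Subtype.val h4
          exact ⟨_, hq, Subtype.ext (Subtype.ext h5)⟩
        · rintro ⟨z, hz, h4⟩
          induction z using Quotient.inductionOn with | h q => ?_
          have h5 : rangeFactorization (𝒰 j).proj q.1 ∈ Subtype.val ⁻¹' F := by
            rw [hFC]
            exact ⟨q.1, ⟨q, hz, rfl⟩, rfl⟩
          have h6 : (𝒰 j).proj q.1 = (𝒰 j).proj p.1 :=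
            congrArg Subtype.val (congrArg Subtype.val h4)
          change (𝒰 j).proj p.1 ∈ F
          rw [← h6]
          exact h5
      · intro a b
        induction a using Quotient.inductionOn with | h p => ?_
        induction b using Quotient.inductionOn with | h q => ?_
        intro h
        obtain ⟨γ, hγ⟩ := (𝒰 j).exists_smul_eq
          (congrArg Subtype.val (congrArg Subtype.val h.symm) : (𝒰 j).proj q.1 = (𝒰 j).proj p.1)
        obtain ⟨l, hl, hlq⟩ := (c.invariant j).exists_smul_eq γ q.1 q.2 (hγ ▸ p.2)
        exact Quotient.sound ⟨((⟨l, hl⟩ : c.subgroup j) : c.subgroup j ⧸ (c.invariant j).kernel),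
          Subtype.ext (hlq.trans hγ)⟩
      · rintro ⟨_, p, rfl⟩
        exact ⟨Quotient.mk _ p, rfl⟩ }

/-- The inclusion `Φ₀ : ∐ⱼ Ṽⱼ → ∐ᵢ Ũᵢ` between the spaces of objects of `𝒢(ℬ)` and `𝒢(𝒰)`, where
`ℬ` is the induced atlas. -/
noncomputable def inclusion [Countable ι] (c : ClosedSuborbifoldCover k 𝒰 Y) :
    (germGroupoid c.inducedChart).Obj → (germGroupoid 𝒰).Obj :=
  fun p : Σ j : c.J, (c.V j).carrier => (⟨p.1.1, p.2.1⟩ : Σ i, (𝒰 i).Dom)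

/-- A morphism `Φ : 𝒢(ℬ) → 𝒢(𝒰)` is compatible with the inclusion `Y ⊆ X` if
`ε ∘ |Φ| : |𝒢(ℬ)| → X` is `ε : |𝒢(ℬ)| → Y` followed by the inclusion. -/
def IsOverInclusion [Countable ι] (c : ClosedSuborbifoldCover k 𝒰 Y)
    (Φ : (germGroupoid c.inducedChart).Hom (germGroupoid 𝒰)) : Prop :=
  ∀ z : (germGroupoid c.inducedChart).OrbitSpace,
    orbitToSpace 𝒰 (Φ.orbitMap z) = (orbitToSpace (X := Y) c.inducedChart z).1

/-- A closed suborbifold cover is strong if there is a Lie groupoid embedding `𝒢(ℬ) → 𝒢(𝒰)`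
compatible with the inclusion `Y ⊆ X`. -/
def IsStrong [Countable ι] (c : ClosedSuborbifoldCover k 𝒰 Y) : Prop :=
  ∃ Φ : (germGroupoid c.inducedChart).Hom (germGroupoid 𝒰), Φ.IsEmbedding ∧ c.IsOverInclusion Φ

/-- A closed suborbifold cover is very strong if (1) an element of `Γⱼ` which fixes some non-empty
open subset of `Ṽⱼ` pointwise is trivial, and (2) any two `Ṽⱼ` are locally related through a
submanifold of a common orbifold chart on `X`. -/
structure IsVeryStrong (c : ClosedSuborbifoldCover k 𝒰 Y) : Prop where
  eq_one : ∀ (j : c.J) (γ : (𝒰 j).Grp) (S : Set (c.V j).carrier), IsOpen S → S.Nonempty →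
    (∀ p ∈ S, γ • (p : (𝒰 j).Dom) = p) → γ = 1
  exists_chart : ∀ (j₁ j₂ : c.J),
    ∀ x ∈ ((𝒰 j₁).proj '' (c.V j₁).carrier) ∩ ((𝒰 j₂).proj '' (c.V j₂).carrier),
    ∃ (W : OrbifoldChart.{u} n X) (L : Subgroup W.Grp) (Z : EmbeddedSubmanifold k n W.Dom),
      IsGroupInvariant L Z.carrier ∧
      x ∈ W.proj '' Z.carrier ∧ W.proj '' Z.carrier ⊆ Y ∧
      IsOpen (Subtype.val ⁻¹' (W.proj '' Z.carrier) : Set Y) ∧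
      (∃ l, W.IsInjection (𝒰 j₁) l ∧ l '' Z.carrier ⊆ (c.V j₁).carrier) ∧
      ∃ l, W.IsInjection (𝒰 j₂) l ∧ l '' Z.carrier ⊆ (c.V j₂).carrier

end ClosedSuborbifoldCover

/-- `Y` is a `k`-dimensional strong suborbifold of the orbifold `(X, 𝒜)` if it has a strong
suborbifold cover with respect to some countable atlas contained in `𝒜`. -/
def IsStrongSuborbifold (k : ℕ) (𝒜 : Set (OrbifoldChart.{u} n X)) (Y : Set X) : Prop :=
  ∃ (ι : Type) (_ : Countable ι) (𝒰 : ι → OrbifoldChart.{u} n X),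
    (∀ i, 𝒰 i ∈ 𝒜) ∧ IsOrbifoldAtlas 𝒰 ∧
    ∃ c : ClosedSuborbifoldCover k 𝒰 Y, c.IsStrong

/-- `Y` is a `k`-dimensional very strong suborbifold of the orbifold `(X, 𝒜)` if it has a very
strong suborbifold cover with respect to some countable atlas contained in `𝒜`. -/
def IsVeryStrongSuborbifold (k : ℕ) (𝒜 : Set (OrbifoldChart.{u} n X)) (Y : Set X) : Prop :=
  ∃ (ι : Type) (_ : Countable ι) (𝒰 : ι → OrbifoldChart.{u} n X),
    (∀ i, 𝒰 i ∈ 𝒜) ∧ IsOrbifoldAtlas 𝒰 ∧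
    ∃ c : ClosedSuborbifoldCover k 𝒰 Y, c.IsVeryStrong

end Covers

/-!
A transition is a local diffeomorphism `f` with `π ∘ f = π`. Everything follows from two facts about
germs of transitions. Every germ of a transition of `∐ Ṽⱼ` is the restriction of a germ of a
transition of `∐ Ũᵢ`, and of only one (`HasUniqueExtensions`). Sending a germ to its extension is
then the only possible morphism `𝒢(ℬ) → 𝒢(𝒰)` over the inclusion (`HasUniqueExtensions.eq_hom`).
It is an immersion because, read through the étale source maps, it is the inclusion of `∐ Ṽⱼ` into
`∐ Ũᵢ`, and a topological embedding because a germ is determined by its extension, continuously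
(`HasUniqueExtensions.isEmbedding_extend`).

Both facts rest on the rigidity of transitions within one chart: a smooth map `h` between open
subsets of `Ũ` with `π ∘ h = π` is locally given by an element of `Γ`
(`OrbifoldChart.eventually_eq_smul`). Here `h(q) ∈ Γq` for every `q`, so the open set is covered by
finitely many closed sets `{h = γ}` and hence by the closures of their interiors. On the closure of
the interior of `{h = γ}` the differentials of `h` and `γ` agree, so at a point common to two
such sets the corresponding elements of `Γ` have the same value and the same differential. They are
then equal: an element of finite order which fixes a point with trivial differential is the identity
near it (average a chart over its powers), hence everywhere, as `Ũ` is connected.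

* Uniqueness: a transition of `∐ Ũᵢ` which fixes `Ṽⱼ` near `p` is near `p` an element of `Γⱼ`
  fixing an open subset of `Ṽⱼ`, which is trivial by condition (1) of a very strong cover.
* Existence: let `g` be a transition between `Ṽ_{j₁}` and `Ṽ_{j₂}`, and let `l₁`, `l₂` be injections
  as in condition (2). They restrict to local diffeomorphisms `Z̃ → Ṽ_{jₘ}`, and by rigidity for
  the induced charts `g` differs from the restriction of `l₂ ∘ l₁⁻¹` by elements of `Δ_{j₁}` and
  `Δ_{j₂}`. Hence `g` extends.
-/

/-! ### Fixed points of maps of finite order -/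

section FixedPoints

variable {n : ℕ} {M : Type*} [TopologicalSpace M] [ChartedSpace (EuclideanSpace ℝ (Fin n)) M]

variable (n) in
/-- A self-map `u` of a manifold, read in the preferred chart at `p` (used when `u p = p`). -/
noncomputable def chartRep (p : M) (u : M → M) :
    EuclideanSpace ℝ (Fin n) → EuclideanSpace ℝ (Fin n) :=
  extChartAt (𝓡 n) p ∘ u ∘ (extChartAt (𝓡 n) p).symm

variable {p : M} {u v : M → M}

theorem tendsto_extChartAt_symm_nhds (p : M) :
    Filter.Tendsto (extChartAt (𝓡 n) p).symm (𝓝 (extChartAt (𝓡 n) p p)) (𝓝 p) := by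
  have := continuousAt_extChartAt_symm (I := 𝓡 n) p
  rwa [ContinuousAt, extChartAt_to_inv] at this

theorem contDiffAt_chartRep (hu : ContMDiffAt (𝓡 n) (𝓡 n) ∞ u p) (hp : u p = p) :
    ContDiffAt ℝ ∞ (chartRep n p u) (extChartAt (𝓡 n) p p) := by
  have h := (contMDiffAt_iff.1 hu).2
  rw [hp] at h
  simpa [contDiffWithinAt_univ, chartRep] using h

theorem chartRep_id_eventuallyEq (p : M) :
    chartRep n p id =ᶠ[𝓝 (extChartAt (𝓡 n) p p)] id := by
  filter_upwards [extChartAt_target_mem_nhds (I := 𝓡 n) p] with y hy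
  exact (extChartAt (𝓡 n) p).right_inv hy

theorem chartRep_comp_eventuallyEq (hv : ContinuousAt v p) (hp : v p = p) :
    chartRep n p (u ∘ v) =ᶠ[𝓝 (extChartAt (𝓡 n) p p)] chartRep n p u ∘ chartRep n p v := by
  have h : Filter.Tendsto v (𝓝 p) (𝓝 p) := by simpa [ContinuousAt, hp] using hv
  filter_upwards [(h.comp (tendsto_extChartAt_symm_nhds (n := n) p)).eventually
    (extChartAt_source_mem_nhds (I := 𝓡 n) p)] with y hy
  exact congrArg (fun z => extChartAt (𝓡 n) p (u z)) ((extChartAt (𝓡 n) p).left_inv hy).symm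

theorem chartRep_apply_self (hp : u p = p) :
    chartRep n p u (extChartAt (𝓡 n) p p) = extChartAt (𝓡 n) p p := by
  simp [chartRep, hp]

/-- Two smooth maps fixing `p` which agree on an open set adherent to `p` have the same
differential at `p`, by continuity of the differential. -/
theorem fderiv_chartRep_eq (hu : ContMDiffAt (𝓡 n) (𝓡 n) ∞ u p)
    (hv : ContMDiffAt (𝓡 n) (𝓡 n) ∞ v p) (hup : u p = p) (hvp : v p = p)
    (h : p ∈ closure (interior {q | u q = v q})) :
    fderiv ℝ (chartRep n p u) (extChartAt (𝓡 n) p p) =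
      fderiv ℝ (chartRep n p v) (extChartAt (𝓡 n) p p) := by
  have hcu := ((contDiffAt_chartRep hu hup).fderiv_right (m := 0) (by simp)).continuousAt
  have hcv := ((contDiffAt_chartRep hv hvp).fderiv_right (m := 0) (by simp)).continuousAt
  have hF : ∃ᶠ q in 𝓝 p, q ∈ interior {q | u q = v q} := mem_closure_iff_frequently.1 h
  have hF' : ∃ᶠ q in 𝓝 p, fderiv ℝ (chartRep n p u) (extChartAt (𝓡 n) p q) =
      fderiv ℝ (chartRep n p v) (extChartAt (𝓡 n) p q) := by
    refine (hF.and_eventually (extChartAt_source_mem_nhds (I := 𝓡 n) p)).mono ?_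
    rintro q ⟨hq, hq'⟩
    refine Filter.EventuallyEq.fderiv_eq ?_
    have h1 : Filter.Tendsto (extChartAt (𝓡 n) p).symm (𝓝 (extChartAt (𝓡 n) p q)) (𝓝 q) := by
      have := continuousAt_extChartAt_symm' (I := 𝓡 n) hq'
      rwa [ContinuousAt, (extChartAt (𝓡 n) p).left_inv hq'] at this
    filter_upwards [h1.eventually (isOpen_interior.mem_nhds hq)] with y hy
    exact congrArg (extChartAt (𝓡 n) p) (interior_subset (s := {q | u q = v q}) hy)
  have hp : Filter.Tendsto (extChartAt (𝓡 n) p) (𝓝 p) (𝓝 (extChartAt (𝓡 n) p p)) :=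
    continuousAt_extChartAt p
  -- otherwise the differentials would differ at all points near `p`
  by_contra hne
  have := ((hcu.tendsto.comp hp).prodMk_nhds (hcv.tendsto.comp hp)).eventually
    ((isClosed_diagonal.isOpen_compl).mem_nhds
      (x := (fderiv ℝ (chartRep n p u) (extChartAt (𝓡 n) p p),
        fderiv ℝ (chartRep n p v) (extChartAt (𝓡 n) p p))) hne)
  obtain ⟨q, hq, hq'⟩ := (hF'.and_eventually this).exists
  exact hq' hq

theorem fderiv_chartRep_id (p : M) :
    fderiv ℝ (chartRep n p id) (extChartAt (𝓡 n) p p) = .id ℝ _ := by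
  rw [(chartRep_id_eventuallyEq p).fderiv_eq, fderiv_id]

section Group

variable {G : Type*} [Group G] [Finite G] [MulAction G M]
  (hG : ∀ γ : G, ContMDiff (𝓡 n) (𝓡 n) ∞ (fun q : M => γ • q))

include hG

/-- An element of a finite group acting smoothly which fixes `p` with trivial differential is the
identity near `p`: averaging the chart over the powers of `γ` gives local coordinates which are
invariant under `γ`. -/
theorem eventually_smul_eq_of_fderiv_eq_id {γ : G} (hp : γ • p = p)
    (hd : fderiv ℝ (chartRep n p (fun q => γ • q)) (extChartAt (𝓡 n) p p) = .id ℝ _) :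
    ∀ᶠ q in 𝓝 p, γ • q = q := by
  set x := extChartAt (𝓡 n) p p with hx
  have hpk : ∀ k : ℕ, γ ^ k • p = p := fun k => by
    induction k with
    | zero => simp
    | succ k ih => rw [pow_succ, mul_smul, hp, ih]
  let g : ℕ → EuclideanSpace ℝ (Fin n) → EuclideanSpace ℝ (Fin n) := fun k =>
    chartRep n p (fun q => γ ^ k • q)
  have hcd : ∀ k, ContDiffAt ℝ ∞ (g k) x := fun k => contDiffAt_chartRep (hG _ p) (hpk k)
  have hcomp : ∀ k, g (k + 1) =ᶠ[𝓝 x] g k ∘ g 1 := fun k => by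
    have h := chartRep_comp_eventuallyEq (n := n) (u := fun q => γ ^ k • q)
      (v := fun q => γ ^ 1 • q) (hG (γ ^ 1)).continuous.continuousAt (hpk 1)
    convert h using 1
    funext y
    simp [g, chartRep, pow_succ, mul_smul]
  have hg1 : g 1 x = x := chartRep_apply_self (hpk 1)
  have hd1 : HasStrictFDerivAt (g 1) (.id ℝ _) x := by
    have h := (hcd 1).hasStrictFDerivAt (by simp)
    have h' : fderiv ℝ (g 1) x = .id ℝ _ := by simpa [g] using hd
    rwa [h'] at h
  have hdk : ∀ k, HasStrictFDerivAt (g k) (.id ℝ _) x := fun k => by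
    induction k with
    | zero =>
      refine (hasStrictFDerivAt_id x).congr_of_eventuallyEq ?_
      filter_upwards [chartRep_id_eventuallyEq (n := n) p] with y hy
      rw [← hy]
      simp [g, chartRep]
    | succ k ih =>
      have h := HasStrictFDerivAt.comp x (g := g k) (by rw [hg1]; exact ih) hd1
      exact h.congr_of_eventuallyEq (hcomp k).symm
  have hm : 0 < orderOf γ := orderOf_pos γ
  have hm' : (orderOf γ : ℝ) ≠ 0 := by exact_mod_cast hm.ne'
  -- the average of the powers of `γ`, read in the chart: invariant under `γ`, and with differential
  -- the identity at `x`, hence injective near `x`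
  let S : EuclideanSpace ℝ (Fin n) → EuclideanSpace ℝ (Fin n) := fun y =>
    (orderOf γ : ℝ)⁻¹ • ∑ k ∈ Finset.range (orderOf γ), g k y
  have hS : HasStrictFDerivAt S
      ((ContinuousLinearEquiv.refl ℝ (EuclideanSpace ℝ (Fin n))) : _ →L[ℝ] _) x := by
    have h := (HasStrictFDerivAt.fun_sum (u := Finset.range (orderOf γ))
      fun k _ => hdk k).const_smul (orderOf γ : ℝ)⁻¹
    have e : ((ContinuousLinearEquiv.refl ℝ (EuclideanSpace ℝ (Fin n))) : _ →L[ℝ] _) =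
        (orderOf γ : ℝ)⁻¹ • ∑ k ∈ Finset.range (orderOf γ),
          ContinuousLinearMap.id ℝ (EuclideanSpace ℝ (Fin n)) := by
      rw [Finset.sum_const, Finset.card_range, ← Nat.cast_smul_eq_nsmul ℝ, smul_smul,
        inv_mul_cancel₀ hm', one_smul]
      rfl
    rw [e]
    exact h
  have hSg : ∀ᶠ y in 𝓝 x, S (g 1 y) = S y := by
    have h : ∀ᶠ y in 𝓝 x, ∀ k ∈ Finset.range (orderOf γ), g (k + 1) y = g k (g 1 y) :=
      (Finset.eventually_all _).2 fun k _ => hcomp k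
    filter_upwards [h] with y hy
    simp only [S]
    rw [← Finset.sum_congr rfl hy]
    -- the sums over `0 ≤ k < m` and `1 ≤ k ≤ m` agree, as `γ ^ m = 1` for `m = orderOf γ`
    have h1 := Finset.sum_range_succ (fun k => g k y) (orderOf γ)
    rw [Finset.sum_range_succ'] at h1
    have h2 : g (orderOf γ) y = g 0 y := by simp [g, chartRep, pow_orderOf_eq_one]
    rw [h2] at h1
    rw [add_right_cancel h1]
  have hinj := hS.toOpenPartialHomeomorph S |>.injOn
  have hsrc := (hS.toOpenPartialHomeomorph S).open_source.mem_nhds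
    hS.mem_toOpenPartialHomeomorph_source
  have hg1c : Filter.Tendsto (g 1) (𝓝 x) (𝓝 x) := by
    have := hd1.continuousAt
    rwa [ContinuousAt, hg1] at this
  have hfix : ∀ᶠ y in 𝓝 x, g 1 y = y := by
    filter_upwards [hSg, hsrc, hg1c.eventually hsrc] with y h1 h2 h3
    exact hinj h3 h2 h1
  have hsm : Filter.Tendsto (fun q : M => γ • q) (𝓝 p) (𝓝 p) := by
    have := (hG γ).continuous.continuousAt (x := p)
    rwa [ContinuousAt, hp] at this
  filter_upwards [(continuousAt_extChartAt (I := 𝓡 n) p).tendsto.eventually hfix,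
    extChartAt_source_mem_nhds (I := 𝓡 n) p,
    hsm.eventually (extChartAt_source_mem_nhds (I := 𝓡 n) p)] with q h1 h2 h3
  refine (extChartAt (𝓡 n) p).injOn h3 h2 ?_
  have h4 : extChartAt (𝓡 n) p (γ ^ 1 • (extChartAt (𝓡 n) p).symm (extChartAt (𝓡 n) p q)) =
      extChartAt (𝓡 n) p q := h1
  rwa [(extChartAt (𝓡 n) p).left_inv h2, pow_one] at h4

variable [T2Space M] [ConnectedSpace M] [FaithfulSMul G M]

/-- In an effective action of a finite group on a connected manifold, an element which fixes a
point with trivial differential is trivial: the interior of its fixed point set is closed. -/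
theorem eq_one_of_fderiv_eq_id {γ : G} (hp : γ • p = p)
    (hd : fderiv ℝ (chartRep n p (fun q => γ • q)) (extChartAt (𝓡 n) p p) = .id ℝ _) :
    γ = 1 := by
  have hc : IsClopen (interior {q : M | γ • q = q}) := by
    refine ⟨isClosed_of_closure_subset fun q hq => ?_, isOpen_interior⟩
    have hcl : IsClosed {q : M | γ • q = q} := isClosed_eq (hG γ).continuous continuous_id
    have hq' : γ • q = q := closure_minimal interior_subset hcl hq
    rw [mem_interior_iff_mem_nhds]
    refine eventually_smul_eq_of_fderiv_eq_id hG hq' ?_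
    rw [fderiv_chartRep_eq (hG γ q) contMDiffAt_id hq' rfl hq, fderiv_chartRep_id]
  have hu := hc.eq_univ ⟨p, mem_interior_iff_mem_nhds.2
    (eventually_smul_eq_of_fderiv_eq_id hG hp hd)⟩
  refine eq_of_smul_eq_smul (α := M) fun q => ?_
  rw [one_smul]
  exact interior_subset (s := {q : M | γ • q = q}) (hu ▸ mem_univ q)

end Group

end FixedPoints

/-! ### Rigidity of transitions within a chart -/

namespace OrbifoldChart

variable {n : ℕ} {X : Type v} [TopologicalSpace X] (φ : OrbifoldChart.{u} n X)

/-- If `h` agrees with `γ` and with `γ'` on open sets adherent to `p`, then `γ` and `γ'` have the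
same value and differential at `p`, namely those of `h`, and are therefore equal. -/
theorem locally_eq_smul_unique {h : φ.Dom → φ.Dom} {p : φ.Dom}
    (hh : ContMDiffAt (𝓡 n) (𝓡 n) ∞ h p) {γ γ' : φ.Grp}
    (hγ : p ∈ closure (interior {q | h q = γ • q})) (hp : h p = γ • p)
    (hγ' : p ∈ closure (interior {q | h q = γ' • q})) (hp' : h p = γ' • p) : γ = γ' := by
  have e1 : γ⁻¹ • h p = p := by rw [hp, inv_smul_smul]
  have e2 : (γ⁻¹ * γ') • p = p := by rw [mul_smul, ← hp', e1]
  have hs : ContMDiffAt (𝓡 n) (𝓡 n) ∞ (fun q => γ⁻¹ • h q) p :=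
    ContMDiffAt.comp p (φ.smooth_smul γ⁻¹ (h p)) hh
  have d1 := fderiv_chartRep_eq hs (φ.smooth_smul (γ⁻¹ * γ') p) e1 e2 (by
    have e : {q | γ⁻¹ • h q = (γ⁻¹ * γ') • q} = {q | h q = γ' • q} := by
      ext q
      rw [mem_ofPred_eq, mul_smul, smul_left_cancel_iff, mem_ofPred_eq]
    rwa [e])
  have d2 := fderiv_chartRep_eq hs contMDiffAt_id e1 rfl (by
    have e : {q | γ⁻¹ • h q = id q} = {q | h q = γ • q} := by
      ext q
      rw [mem_ofPred_eq, inv_smul_eq_iff, mem_ofPred_eq, id]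
    rwa [e])
  rw [fderiv_chartRep_id, d1] at d2
  exact inv_mul_eq_one.1 (eq_one_of_fderiv_eq_id φ.smooth_smul e2 d2)

/-- A smooth map between open subsets of `Ũ` over `X` is locally given by the elements of `Γ`.
The open set is covered by the closed sets `{h = γ}`, hence by the closures of their interiors;
on each of these the differential of `h` is that of `γ`, so they are pairwise disjoint. -/
theorem eventually_eq_smul {h : φ.Dom → φ.Dom} {O : Set φ.Dom} (hO : IsOpen O)
    (hh : ContMDiffOn (𝓡 n) (𝓡 n) ∞ h O) (hπ : ∀ q ∈ O, φ.proj (h q) = φ.proj q)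
    {p : φ.Dom} (hp : p ∈ O) : ∃ γ : φ.Grp, ∀ᶠ q in 𝓝 p, h q = γ • q := by
  have : LocallyCompactSpace φ.Dom := ChartedSpace.locallyCompactSpace (EuclideanSpace ℝ (Fin n)) _
  have hsm : ∀ {q}, q ∈ O → ContMDiffAt (𝓡 n) (𝓡 n) ∞ h q := fun hq =>
    hh.contMDiffAt (hO.mem_nhds hq)
  let C : φ.Grp → Set φ.Dom := fun γ => {q | h q = γ • q}
  have hcl : ∀ γ, ∀ q ∈ O, q ∈ closure (C γ) → h q = γ • q := fun γ q hq hqc => by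
    by_contra hne
    have hev := ((hsm hq).continuousAt.prodMk
      ((φ.smooth_smul γ).continuous.continuousAt (x := q))).eventually
      (isClosed_diagonal.isOpen_compl.mem_nhds (x := (h q, γ • q)) hne)
    obtain ⟨z, hz, hz'⟩ := ((mem_closure_iff_frequently.1 hqc).and_eventually hev).exists
    exact hz' hz
  have hex : ∀ q ∈ O, ∃ γ, q ∈ closure (interior (C γ)) := fun q hq => by
    -- closed sets covering all of `Ũ`, one of which is the complement of `O`
    let D : Option φ.Grp → Set φ.Dom := fun o => o.elim Oᶜ fun γ => closure (C γ)
    have hd : Dense (⋃ o, interior (D o)) := by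
      refine dense_iUnion_interior_of_closed ?_ ?_
      · rintro (_ | γ)
        exacts [hO.isClosed_compl, isClosed_closure]
      · refine eq_univ_of_forall fun z => mem_iUnion.2 ?_
        by_cases hz : z ∈ O
        · obtain ⟨γ, hγ⟩ := φ.exists_smul_eq (hπ z hz).symm
          exact ⟨some γ, subset_closure hγ.symm⟩
        · exact ⟨none, hz⟩
    have hq' := hd.open_subset_closure_inter hO hq
    rw [inter_iUnion, closure_iUnion_of_finite] at hq'
    obtain ⟨o, ho⟩ := mem_iUnion.1 hq'
    rcases o with _ | γ
    · have : O ∩ interior (D none) = ∅ :=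
        eq_empty_of_forall_notMem fun z hz => interior_subset hz.2 hz.1
      rw [this] at ho
      simp at ho
    · exact ⟨γ, closure_mono (interior_maximal
        (fun z hz => hcl γ z hz.1 (interior_subset hz.2)) (hO.inter isOpen_interior)) ho⟩
  obtain ⟨γ, hγ⟩ := hex p hp
  refine ⟨γ, ?_⟩
  have hne : ∀ γ', γ' ≠ γ → ∀ᶠ q in 𝓝 p, q ∉ closure (interior (C γ')) := fun γ' hγ' => by
    refine isClosed_closure.isOpen_compl.mem_nhds fun hm => hγ' ?_
    exact φ.locally_eq_smul_unique (hsm hp) hm (hcl _ p hp (closure_mono interior_subset hm))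
      hγ (hcl _ p hp (closure_mono interior_subset hγ))
  have hall : ∀ᶠ q in 𝓝 p, ∀ γ', γ' ≠ γ → q ∉ closure (interior (C γ')) := by
    refine Filter.eventually_all.2 fun γ' => ?_
    by_cases e : γ' = γ
    · simp [e]
    · simpa [e] using hne γ' e
  filter_upwards [hall, hO.mem_nhds hp] with q hq hqO
  obtain ⟨γ', hγ'⟩ := hex q hqO
  obtain rfl : γ' = γ := by
    by_contra e
    exact hq γ' e hγ'
  exact hcl _ q hqO (closure_mono interior_subset hγ')

end OrbifoldChart

/-! ### Smooth local left inverses and immersions -/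

section LeftInverse

variable {l m n : ℕ} {L M N : Type*}
  [TopologicalSpace L] [ChartedSpace (EuclideanSpace ℝ (Fin l)) L]
  [TopologicalSpace M] [ChartedSpace (EuclideanSpace ℝ (Fin m)) M]
  [TopologicalSpace N] [ChartedSpace (EuclideanSpace ℝ (Fin n)) N]

variable (m n) in
/-- The map `f` has a left inverse near `p` which is defined and smooth near `f p`. For a smooth
map between finite-dimensional manifolds this is equivalent to being an immersion at `p`; in this
form the notion composes and restricts without effort. -/
def HasSmoothLeftInverseAt (f : M → N) (p : M) : Prop :=
  ∃ (r : N → M) (O : Set N), IsOpen O ∧ f p ∈ O ∧ ContMDiffOn (𝓡 n) (𝓡 m) ∞ r O ∧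
    ∀ᶠ q in 𝓝 p, r (f q) = q

theorem Manifold.IsImmersionAt.hasSmoothLeftInverseAt {f : M → N} {p : M}
    (h : IsImmersionAt (𝓡 m) (𝓡 n) ∞ f p) : HasSmoothLeftInverseAt m n f p := by
  set φ := h.domChart
  set ψ := h.codChart
  have hw : ∀ q ∈ φ.source, ψ (f q) = h.equiv (φ q, 0) := fun q hq => by
    have hq' : φ q ∈ (φ.extend (𝓡 m)).target := by simpa using φ.map_source hq
    simpa [φ, ψ, φ.left_inv hq] using h.writtenInCharts hq'
  have hc : Continuous fun y => (h.equiv.symm y).1 := by fun_prop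
  have hs : ContDiff ℝ ∞ fun y => (h.equiv.symm y).1 :=
    contDiff_fst.comp h.equiv.symm.contDiff
  refine ⟨fun y => φ.symm (h.equiv.symm (ψ y)).1,
    ψ.source ∩ (fun y => (h.equiv.symm (ψ y)).1) ⁻¹' φ.target,
    (hc.comp_continuousOn ψ.continuousOn).isOpen_inter_preimage ψ.open_source φ.open_target,
    ⟨h.mem_codChart_source, ?_⟩, ?_, ?_⟩
  · rw [mem_preimage, hw p h.mem_domChart_source, h.equiv.symm_apply_apply]
    exact φ.map_source h.mem_domChart_source
  · refine (contMDiffOn_symm_of_mem_maximalAtlas h.domChart_mem_maximalAtlas).comp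
      (t := φ.target) (hs.contMDiff.comp_contMDiffOn
        ((contMDiffOn_of_mem_maximalAtlas h.codChart_mem_maximalAtlas).mono inter_subset_left))
      fun y hy => hy.2
  · filter_upwards [φ.open_source.mem_nhds h.mem_domChart_source] with q hq
    rw [hw q hq, h.equiv.symm_apply_apply, φ.left_inv hq]

namespace HasSmoothLeftInverseAt

theorem comp {f : L → M} {g : M → N} {p : L} (hg : HasSmoothLeftInverseAt m n g (f p))
    (hf : HasSmoothLeftInverseAt l m f p) (hfc : ContinuousAt f p) :
    HasSmoothLeftInverseAt l n (g ∘ f) p := by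
  obtain ⟨r, O, hO, hp, hr, hrf⟩ := hf
  obtain ⟨s, O', hO', hp', hs, hsg⟩ := hg
  refine ⟨r ∘ s, O' ∩ s ⁻¹' O, hs.continuousOn.isOpen_inter_preimage hO' hO,
    ⟨hp', ?_⟩, hr.comp (hs.mono inter_subset_left) fun y hy => hy.2, ?_⟩
  · rw [mem_preimage, Function.comp_apply, hsg.self_of_nhds]
    exact hp
  · filter_upwards [hrf, hfc.tendsto.eventually hsg] with q h1 h2
    simp only [Function.comp_apply, h2, h1]

theorem of_comp {f : L → M} {g : M → N} {p : L} (h : HasSmoothLeftInverseAt l n (g ∘ f) p)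
    (hg : ContMDiff (𝓡 m) (𝓡 n) ∞ g) : HasSmoothLeftInverseAt l m f p := by
  obtain ⟨r, O, hO, hp, hr, hrf⟩ := h
  exact ⟨r ∘ g, g ⁻¹' O, hO.preimage hg.continuous, hp, hr.comp hg.contMDiffOn fun _ hy => hy, hrf⟩

/-- In equal dimensions, a smooth map with a smooth local left inverse is a local diffeomorphism,
by the inverse function theorem. -/
theorem isLocalDiffeomorphAt {M' : Type*} [TopologicalSpace M']
    [ChartedSpace (EuclideanSpace ℝ (Fin n)) M'] {f : M' → N} {p : M'}
    (h : HasSmoothLeftInverseAt n n f p) (hf : ContMDiff (𝓡 n) (𝓡 n) ∞ f) :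
    IsLocalDiffeomorphAt (𝓡 n) (𝓡 n) ∞ f p := by
  obtain ⟨r, O, hO, hp, hr, hrf⟩ := h
  set φ := extChartAt (𝓡 n) p
  set ψ := extChartAt (𝓡 n) (f p)
  have hrp : r (f p) = p := hrf.self_of_nhds
  have hF : ContDiffAt ℝ ∞ (ψ ∘ f ∘ φ.symm) (φ p) := by
    simpa [contDiffWithinAt_univ, φ, ψ] using (contMDiffAt_iff.1 (hf p)).2
  have hR : ContDiffAt ℝ ∞ (φ ∘ r ∘ ψ.symm) (ψ (f p)) := by
    have := (contMDiffAt_iff.1 (hr.contMDiffAt (hO.mem_nhds hp))).2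
    rw [hrp] at this
    simpa [contDiffWithinAt_univ, φ, ψ] using this
  have hφ : Filter.Tendsto φ.symm (𝓝 (φ p)) (𝓝 p) := tendsto_extChartAt_symm_nhds p
  have hRF : (φ ∘ r ∘ ψ.symm) ∘ (ψ ∘ f ∘ φ.symm) =ᶠ[𝓝 (φ p)] id := by
    filter_upwards [hφ.eventually hrf, extChartAt_target_mem_nhds (I := 𝓡 n) p,
      hφ.eventually (hf.continuous.continuousAt.tendsto.eventually
        (extChartAt_source_mem_nhds (I := 𝓡 n) (f p)))] with y h1 h2 h3
    simp only [Function.comp_apply, id_eq]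
    rw [ψ.left_inv h3, h1, φ.right_inv h2]
  have hFp : (ψ ∘ f ∘ φ.symm) (φ p) = ψ (f p) := by simp [φ, ψ]
  have hdF := hF.hasStrictFDerivAt (by simp)
  have hdR := hR.hasStrictFDerivAt (by simp)
  rw [← hFp] at hdR
  have hd := ((hdR.comp (φ p) hdF).hasFDerivAt.congr_of_eventuallyEq hRF.symm).unique
    (hasFDerivAt_id (φ p))
  have hinj : Function.Injective (fderiv ℝ (ψ ∘ f ∘ φ.symm) (φ p)) := fun a b hab => by
    have ha := DFunLike.congr_fun hd a
    have hb := DFunLike.congr_fun hd b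
    simp only [ContinuousLinearMap.comp_apply, hab, ContinuousLinearMap.id_apply] at ha hb
    exact ha.symm.trans hb
  have hsurj : Function.Surjective (fderiv ℝ (ψ ∘ f ∘ φ.symm) (φ p)).toLinearMap :=
    LinearMap.injective_iff_surjective.1 hinj
  have hmap := hdF.map_nhds_eq_of_surj (LinearMap.range_eq_top.2 hsurj)
  -- `f` is open at `p`, so its left inverse `r` is a two-sided inverse near `f p`
  have hopen : Filter.map f (𝓝 p) = 𝓝 (f p) := by
    have hψ : Filter.map ψ.symm (𝓝 (ψ (f p))) = 𝓝 (f p) := by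
      rw [← map_extChartAt_nhds_of_boundaryless (I := 𝓡 n) (f p), Filter.map_map]
      refine (Filter.map_congr ?_).trans Filter.map_id
      filter_upwards [extChartAt_source_mem_nhds (I := 𝓡 n) (f p)] with y hy
      exact ψ.left_inv hy
    have hφ' : Filter.map φ (𝓝 p) = 𝓝 (φ p) := map_extChartAt_nhds_of_boundaryless p
    rw [← hψ, ← hFp, ← hmap, ← hφ', Filter.map_map, Filter.map_map]
    refine Filter.map_congr ?_
    filter_upwards [extChartAt_source_mem_nhds (I := 𝓡 n) p,
      hf.continuous.continuousAt.tendsto.eventually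
        (extChartAt_source_mem_nhds (I := 𝓡 n) (f p))] with q h1 h2
    simp only [Function.comp_apply]
    rw [φ.left_inv h1, ψ.left_inv h2]
  have hT : ∀ᶠ y in 𝓝 (f p), y ∈ O ∧ f (r y) = y := by
    rw [← hopen, Filter.eventually_map]
    filter_upwards [hrf, hf.continuous.continuousAt.tendsto.eventually (hO.mem_nhds hp)]
      with q h1 h2
    exact ⟨h2, by rw [h1]⟩
  obtain ⟨T, hTs, hTo, hTp⟩ := mem_nhds_iff.1 hT
  obtain ⟨U, hUs, hUo, hUp⟩ := mem_nhds_iff.1 hrf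
  have hUT : IsOpen (T ∩ r ⁻¹' U) :=
    (hr.continuousOn.mono fun y hy => (hTs hy).1).isOpen_inter_preimage hTo hUo
  refine ⟨{ toFun := f
            invFun := r
            source := U ∩ f ⁻¹' T
            target := T ∩ r ⁻¹' U
            map_source' := fun q hq => ⟨hq.2, by rw [mem_preimage, hUs hq.1]; exact hq.1⟩
            map_target' := fun y hy => ⟨hy.2, by rw [mem_preimage, (hTs hy.1).2]; exact hy.1⟩
            left_inv' := fun q hq => hUs hq.1
            right_inv' := fun y hy => (hTs hy.1).2
            open_source := hUo.inter (hTo.preimage hf.continuous)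
            open_target := hUT
            contMDiffOn_toFun := hf.contMDiffOn
            contMDiffOn_invFun := hr.mono fun y hy => (hTs hy.1).1 }, ⟨hUp, hTp⟩, fun _ _ => rfl⟩

end HasSmoothLeftInverseAt

theorem Manifold.IsImmersionAt.isLocalDiffeomorphAt {M' : Type*} [TopologicalSpace M']
    [ChartedSpace (EuclideanSpace ℝ (Fin n)) M'] {f : M' → N} {p : M'}
    (h : IsImmersionAt (𝓡 n) (𝓡 n) ∞ f p) (hf : ContMDiff (𝓡 n) (𝓡 n) ∞ f) :
    IsLocalDiffeomorphAt (𝓡 n) (𝓡 n) ∞ f p :=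
  h.hasSmoothLeftInverseAt.isLocalDiffeomorphAt hf

/-- A local diffeomorphism maps the neighbourhood filter onto the neighbourhood filter. -/
theorem IsLocalDiffeomorphAt.map_nhds_eq {M' : Type*} [TopologicalSpace M']
    [ChartedSpace (EuclideanSpace ℝ (Fin n)) M'] {f : M' → N} {p : M'}
    (h : IsLocalDiffeomorphAt (𝓡 n) (𝓡 n) ∞ f p) : Filter.map f (𝓝 p) = 𝓝 (f p) := by
  obtain ⟨Φ, hp, hΦ⟩ := h
  rw [hΦ hp]
  refine (Filter.map_congr ?_).trans (Φ.toOpenPartialHomeomorph.map_nhds_eq hp)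
  filter_upwards [Φ.open_source.mem_nhds hp] with q hq
  exact hΦ hq

theorem PartialDiffeomorph.trans_mem_maximalAtlas {M' : Type*} [TopologicalSpace M']
    [ChartedSpace (EuclideanSpace ℝ (Fin n)) M'] [IsManifold (𝓡 n) ∞ M'] [IsManifold (𝓡 n) ∞ N]
    (Θ : PartialDiffeomorph (𝓡 n) (𝓡 n) M' N ∞)
    {χ : OpenPartialHomeomorph N (EuclideanSpace ℝ (Fin n))}
    (hχ : χ ∈ IsManifold.maximalAtlas (𝓡 n) ∞ N) :
    Θ.toOpenPartialHomeomorph ≫ₕ χ ∈ IsManifold.maximalAtlas (𝓡 n) ∞ M' := by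
  apply OpenPartialHomeomorph.mem_maximalAtlas_of_contMDiffOn
  · rw [OpenPartialHomeomorph.trans_source]
    exact (contMDiffOn_of_mem_maximalAtlas hχ).comp
      (Θ.contMDiffOn_toFun.mono inter_subset_left) inter_subset_right
  · rw [OpenPartialHomeomorph.trans_target]
    exact ContMDiffOn.comp (t := Θ.target) Θ.contMDiffOn_invFun
      ((contMDiffOn_symm_of_mem_maximalAtlas hχ).mono inter_subset_left) (fun y hy => hy.2)

/-- If `e' ∘ g = f ∘ e` near `p` with local diffeomorphisms `e` and `e'`, and `f` is an immersion at
`e p`, then `g` is an immersion at `p`. -/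
theorem Manifold.IsImmersionAtOfComplement.of_isLocalDiffeomorphAt {F : Type*}
    [NormedAddCommGroup F] [NormedSpace ℝ F]
    {M' N' : Type*} [TopologicalSpace M'] [ChartedSpace (EuclideanSpace ℝ (Fin m)) M']
    [IsManifold (𝓡 m) ∞ M'] [IsManifold (𝓡 m) ∞ M] [IsManifold (𝓡 n) ∞ N]
    [TopologicalSpace N'] [ChartedSpace (EuclideanSpace ℝ (Fin n)) N'] [IsManifold (𝓡 n) ∞ N']
    {f : M → N} {g : M' → N'} {e : M' → M} {e' : N' → N} {p : M'}
    (hf : IsImmersionAtOfComplement F (𝓡 m) (𝓡 n) ∞ f (e p))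
    (he : IsLocalDiffeomorphAt (𝓡 m) (𝓡 m) ∞ e p)
    (he' : IsLocalDiffeomorphAt (𝓡 n) (𝓡 n) ∞ e' (g p))
    (hg : ContinuousAt g p) (heq : e' ∘ g =ᶠ[𝓝 p] f ∘ e) :
    IsImmersionAtOfComplement F (𝓡 m) (𝓡 n) ∞ g p := by
  obtain ⟨Φ, hp, hΦ⟩ := he
  obtain ⟨Ψ, hgp, hΨ⟩ := he'
  have hev : ∀ᶠ q in 𝓝 p, e' (g q) = f (e q) ∧ g q ∈ Ψ.source :=
    heq.and (hg.tendsto.eventually (Ψ.open_source.mem_nhds hgp))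
  obtain ⟨U, hU, hUo, hUp⟩ := mem_nhds_iff.1 hev
  have hsrc : (Φ.toOpenPartialHomeomorph ≫ₕ hf.domChart).source =
      Φ.source ∩ Φ ⁻¹' hf.domChart.source := OpenPartialHomeomorph.trans_source _ _
  refine IsImmersionAtOfComplement.mk_of_continuousAt hg hf.equiv
    ((Φ.toOpenPartialHomeomorph ≫ₕ hf.domChart).restr U)
    (Ψ.toOpenPartialHomeomorph ≫ₕ hf.codChart) ?_ ?_
    (restr_mem_maximalAtlas _ (Φ.trans_mem_maximalAtlas hf.domChart_mem_maximalAtlas) hUo)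
    (Ψ.trans_mem_maximalAtlas hf.codChart_mem_maximalAtlas) ?_
  · rw [OpenPartialHomeomorph.restr_source' _ _ hUo, hsrc]
    refine ⟨⟨hp, ?_⟩, hUp⟩
    rw [mem_preimage, ← hΦ hp]
    exact hf.mem_domChart_source
  · rw [OpenPartialHomeomorph.trans_source]
    refine ⟨hgp, ?_⟩
    have h1 : Ψ (g p) = f (e p) := (hΨ hgp).symm.trans (hU hUp).1
    exact (congrArg (· ∈ hf.codChart.source) h1).mpr hf.mem_codChart_source
  · intro z hz
    have hz' : z ∈ ((Φ.toOpenPartialHomeomorph ≫ₕ hf.domChart).restr U).target := by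
      simpa using hz
    set q := ((Φ.toOpenPartialHomeomorph ≫ₕ hf.domChart).restr U).symm z with hq
    have hqs := ((Φ.toOpenPartialHomeomorph ≫ₕ hf.domChart).restr U).map_target hz'
    have hqz : hf.domChart (Φ q) = z :=
      ((Φ.toOpenPartialHomeomorph ≫ₕ hf.domChart).restr U).right_inv hz'
    rw [OpenPartialHomeomorph.restr_source' _ _ hUo, hsrc] at hqs
    have hzt : z ∈ (hf.domChart.extend (𝓡 m)).target := by
      have h1 : hf.domChart (Φ q) ∈ hf.domChart.target := hf.domChart.map_source hqs.1.2
      rw [hqz] at h1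
      simpa using h1
    have hsy : hf.domChart.symm z = Φ q := by
      rw [← hqz, hf.domChart.left_inv hqs.1.2]
    have h2 : Ψ (g q) = f (Φ q) := by
      rw [← hΨ (hU hqs.2).2, (hU hqs.2).1, hΦ hqs.1.1]
    have hw' : hf.codChart (f (hf.domChart.symm z)) = hf.equiv (z, 0) := by
      simpa using hf.writtenInCharts hzt
    rw [hsy, ← h2] at hw'
    exact hw'

end LeftInverse

/-! ### Germs of transitions of a submanifold -/

section Extension

variable {k n : ℕ} {N M : Type u} {Y : Type v} {X : Type w}
  [TopologicalSpace N] [ChartedSpace (EuclideanSpace ℝ (Fin k)) N]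
  [TopologicalSpace M] [ChartedSpace (EuclideanSpace ℝ (Fin n)) M]
  {πN : N → Y} {πM : M → X} {i : N → M}

variable (k n) in
/-- Along the map `i : N → M`, every transition of `N` extends locally to a transition of `M`, and
the germ of the extension is unique. Uniqueness is only required for extensions of the identity, to
which the general case reduces by composing with an inverse, see `HasUniqueExtensions.eventuallyEq`.
-/
structure HasUniqueExtensions (πN : N → Y) (πM : M → X) (i : N → M) : Prop where
  exists_extension : ∀ g, IsTransition k πN g → ∀ p ∈ g.source,
    ∃ f, IsTransition n πM f ∧ i p ∈ f.source ∧ f ∘ i =ᶠ[𝓝 p] i ∘ g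
  eventuallyEq_id : ∀ f, IsTransition n πM f → ∀ p, i p ∈ f.source → f ∘ i =ᶠ[𝓝 p] i →
    f =ᶠ[𝓝 (i p)] id

namespace HasUniqueExtensions

theorem eventuallyEq (h : HasUniqueExtensions k n πN πM i) (hi : Continuous i)
    {f f' : OpenPartialHomeomorph M M} (hf : IsTransition n πM f) (hf' : IsTransition n πM f')
    {p : N} (hp : i p ∈ f.source) (hp' : i p ∈ f'.source) (he : f ∘ i =ᶠ[𝓝 p] f' ∘ i) :
    f =ᶠ[𝓝 (i p)] f' := by
  have hfp : f (i p) = f' (i p) := he.eq_of_nhds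
  have hs : i p ∈ (f ≫ₕ f'.symm).source := by
    rw [OpenPartialHomeomorph.trans_source]
    refine ⟨hp, ?_⟩
    rw [mem_preimage, hfp]
    exact f'.map_source hp'
  have h1 := h.eventuallyEq_id _ (hf.trans hf'.symm) p hs (by
    filter_upwards [he, hi.continuousAt.eventually (f'.open_source.mem_nhds hp')] with q hq hq'
    rw [Function.comp_apply, OpenPartialHomeomorph.trans_apply]
    exact (congrArg f'.symm hq).trans (f'.left_inv hq'))
  filter_upwards [h1, (f ≫ₕ f'.symm).open_source.mem_nhds hs] with y hy hy'
  rw [OpenPartialHomeomorph.trans_source] at hy'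
  have h2 := f'.right_inv hy'.2
  rw [OpenPartialHomeomorph.trans_apply] at hy
  rw [hy] at h2
  exact h2.symm

theorem exists_germ (h : HasUniqueExtensions k n πN πM i) (a : TransitionGerm k πN) :
    ∃ b : TransitionGerm n πM, ∃ g hg p hp f hf hp', a = .mk g hg p hp ∧
      b = .mk f hf (i p) hp' ∧ f ∘ i =ᶠ[𝓝 p] i ∘ g := by
  induction a using TransitionGerm.ind with | h g hg p hp => ?_
  obtain ⟨f, hf, hp', e⟩ := h.exists_extension g hg p hp
  exact ⟨.mk f hf (i p) hp', g, hg, p, hp, f, hf, hp', rfl, rfl, e⟩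

/-- The germ of the extensions of a germ. -/
noncomputable def extend (h : HasUniqueExtensions k n πN πM i) (a : TransitionGerm k πN) :
    TransitionGerm n πM :=
  (h.exists_germ a).choose

theorem extend_mk (h : HasUniqueExtensions k n πN πM i) (hi : Continuous i)
    {g : OpenPartialHomeomorph N N} {f : OpenPartialHomeomorph M M} (hg : IsTransition k πN g)
    (hf : IsTransition n πM f) {p : N} (hp : p ∈ g.source) (hp' : i p ∈ f.source)
    (he : f ∘ i =ᶠ[𝓝 p] i ∘ g) : h.extend (.mk g hg p hp) = .mk f hf (i p) hp' := by
  obtain ⟨g', hg', q, hq, f', hf', hq', e1, e2, e3⟩ := (h.exists_germ (.mk g hg p hp)).choose_spec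
  obtain ⟨rfl, e4⟩ := TransitionGerm.mk_eq_mk.1 e1
  refine e2.trans (TransitionGerm.mk_eq_mk.2 ⟨rfl, h.eventuallyEq hi hf' hf hq' hp' ?_⟩)
  exact e3.trans ((e4.symm.fun_comp i).trans he.symm)

/-- To prove a property of a germ and its extension, one may choose representatives `g` and `f` of
both such that `f` extends `g`. -/
theorem extend_ind (h : HasUniqueExtensions k n πN πM i) (hi : Continuous i)
    {P : TransitionGerm k πN → TransitionGerm n πM → Prop}
    (H : ∀ (g : OpenPartialHomeomorph N N) (hg : IsTransition k πN g) (p : N) (hp : p ∈ g.source)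
      (f : OpenPartialHomeomorph M M) (hf : IsTransition n πM f) (hp' : i p ∈ f.source),
      f ∘ i =ᶠ[𝓝 p] i ∘ g → P (.mk g hg p hp) (.mk f hf (i p) hp'))
    (a : TransitionGerm k πN) : P a (h.extend a) := by
  induction a using TransitionGerm.ind with | h g hg p hp => ?_
  obtain ⟨f, hf, hp', e⟩ := h.exists_extension g hg p hp
  rw [h.extend_mk hi hg hf hp hp' e]
  exact H _ _ _ _ _ _ _ e

theorem src_extend (h : HasUniqueExtensions k n πN πM i) (hi : Continuous i)
    (a : TransitionGerm k πN) : (h.extend a).src = i a.src :=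
  h.extend_ind hi (P := fun a b => b.src = i a.src) (fun _ _ _ _ _ _ _ _ => rfl) a

theorem tgt_extend (h : HasUniqueExtensions k n πN πM i) (hi : Continuous i)
    (a : TransitionGerm k πN) : (h.extend a).tgt = i a.tgt :=
  h.extend_ind hi (P := fun a b => b.tgt = i a.tgt) (fun _ _ _ _ _ _ _ e => e.eq_of_nhds) a

theorem extend_unit (h : HasUniqueExtensions k n πN πM i) (hi : Continuous i) (p : N) :
    h.extend (.unit p) = .unit (i p) :=
  h.extend_mk hi _ _ _ _ Filter.EventuallyEq.rfl

theorem extend_inv (h : HasUniqueExtensions k n πN πM i) (hi : Continuous i)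
    (a : TransitionGerm k πN) : h.extend a.inv = (h.extend a).inv := by
  refine h.extend_ind hi (P := fun a b => h.extend a.inv = b.inv)
    (fun g hg p hp f hf hp' e => ?_) a
  have e0 : f (i p) = i (g p) := e.eq_of_nhds
  have h1 : i (g p) ∈ f.symm.source := e0 ▸ f.map_source hp'
  rw [TransitionGerm.inv_mk, TransitionGerm.inv_mk]
  refine (h.extend_mk hi hg.symm hf.symm _ h1 ?_).trans
    (TransitionGerm.mk_eq_mk.2 ⟨e0.symm, Filter.EventuallyEq.rfl⟩)
  have h2 : Filter.Tendsto g.symm (𝓝 (g p)) (𝓝 p) := by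
    have := g.continuousAt_symm (g.map_source hp)
    rwa [ContinuousAt, g.left_inv hp] at this
  filter_upwards [h2.eventually e, g.open_target.mem_nhds (g.map_source hp),
    h2.eventually (hi.continuousAt.eventually (f.open_source.mem_nhds hp'))] with y h3 h4 h5
  simp only [Function.comp_apply, g.right_inv h4] at h3
  rw [Function.comp_apply, ← h3, f.left_inv h5]
  rfl

theorem extend_comp (h : HasUniqueExtensions k n πN πM i) (hi : Continuous i)
    (b a : TransitionGerm k πN) (hba : b.src = a.tgt) :
    h.extend (b.comp a) = (h.extend b).comp (h.extend a) := by
  revert hba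
  refine h.extend_ind hi (P := fun b c => b.src = a.tgt → h.extend (b.comp a) = c.comp (h.extend a))
    (fun g hg p hp f hf hp' e => ?_) b
  refine h.extend_ind hi (P := fun a d => p = a.tgt →
    h.extend (TransitionGerm.comp (.mk g hg p hp) a) = TransitionGerm.comp (.mk f hf (i p) hp') d)
    (fun g' hg' q hq f' hf' hq' e' => ?_) a
  intro (hpq : p = g' q)
  subst hpq
  have e0 : f' (i q) = i (g' q) := e'.eq_of_nhds
  have hs : i q ∈ (f' ≫ₕ f).source := by
    rw [OpenPartialHomeomorph.trans_source]
    exact ⟨hq', by rw [mem_preimage, e0]; exact hp'⟩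
  have hs' : q ∈ (g' ≫ₕ g).source := by
    rw [OpenPartialHomeomorph.trans_source]
    exact ⟨hq, hp⟩
  refine (congrArg h.extend (TransitionGerm.comp_mk' rfl)).trans ?_
  refine Eq.trans ?_ (TransitionGerm.comp_mk' e0).symm
  refine h.extend_mk hi (hg'.trans hg) (hf'.trans hf) hs' hs ?_
  filter_upwards [e', (g'.continuousAt hq).eventually e] with y h1 h2
  rw [Function.comp_apply, OpenPartialHomeomorph.trans_apply]
  exact (congrArg f h1).trans h2

/-- Near the germ of `g` at `p`, the extension of germs is `[g]_q ↦ [f]_q` for an extension `f`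
of `g`. -/
theorem extend_eventuallyEq (h : HasUniqueExtensions k n πN πM i) (hi : Continuous i)
    {g : OpenPartialHomeomorph N N} {f : OpenPartialHomeomorph M M} (hg : IsTransition k πN g)
    (hf : IsTransition n πM f) {p : N} (hp : p ∈ g.source) (hp' : i p ∈ f.source)
    (he : f ∘ i =ᶠ[𝓝 p] i ∘ g) :
    h.extend =ᶠ[𝓝 (.mk g hg p hp)] TransitionGerm.sec f hf ∘ i ∘ TransitionGerm.src := by
  have h1 : ∀ᶠ a in 𝓝 (TransitionGerm.mk g hg p hp), f ∘ i =ᶠ[𝓝 a.src] i ∘ g :=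
    (TransitionGerm.continuous_src (n := k) (π := πN)).continuousAt.eventually
      (p := fun q => f ∘ i =ᶠ[𝓝 q] i ∘ g) he.eventuallyEq_nhds
  have h2 : ∀ᶠ a in 𝓝 (TransitionGerm.mk g hg p hp), i a.src ∈ f.source :=
    (hi.comp TransitionGerm.continuous_src).continuousAt.eventually (f.open_source.mem_nhds hp')
  filter_upwards [h1, h2, (TransitionGerm.isOpen_germSet g hg).mem_nhds ⟨p, hp, rfl⟩]
  rintro _ h3 h4 ⟨q, hq, rfl⟩
  exact (h.extend_mk hi hg hf hq h4 h3).trans (TransitionGerm.sec_eq h4).symm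

variable [IsManifold (𝓡 k) ∞ N] [IsManifold (𝓡 n) ∞ M]

theorem contMDiff_extend (h : HasUniqueExtensions k n πN πM i) (hi : ContMDiff (𝓡 k) (𝓡 n) ∞ i) :
    ContMDiff (𝓡 k) (𝓡 n) ∞ h.extend := by
  refine TransitionGerm.ind fun g hg p hp => ?_
  obtain ⟨f, hf, hp', e⟩ := h.exists_extension g hg p hp
  refine ContMDiffAt.congr_of_eventuallyEq ?_ (h.extend_eventuallyEq hi.continuous hg hf hp hp' e)
  refine ContMDiffAt.comp (TransitionGerm.mk g hg p hp)
    (g := TransitionGerm.sec f hf) (I' := 𝓡 n)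
    ((TransitionGerm.contMDiffOn_sec f hf).contMDiffAt (f.open_source.mem_nhds hp')) ?_
  exact (hi.comp TransitionGerm.isLocalDiffeomorph_src.contMDiff) _

omit [IsManifold (𝓡 n) ∞ M] in
/-- The topology of germs on `N` is induced by that on `M`: let `f` extend `g`. A germ at `q ∈ U`
whose extension is a germ of `f` is the germ of `g` at `q`, so the neighbourhoods
`{[f]_y | y ∈ U'}` of `[f]_{i p}` with `i⁻¹ U' = U` cut out the neighbourhoods
`{[g]_q | q ∈ U}` of `[g]_p`. -/
theorem isEmbedding_extend (h : HasUniqueExtensions k n πN πM i) (hi : IsEmbedding i)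
    (hc : Continuous h.extend) : IsEmbedding h.extend := by
  refine ⟨isInducing_iff_nhds.2 fun a => le_antisymm (hc.continuousAt.tendsto.le_comap) ?_, ?_⟩
  · revert a
    refine TransitionGerm.ind fun g hg p hp s hs => ?_
    obtain ⟨f, hf, hp', e⟩ := h.exists_extension g hg p hp
    have hsec : ∀ᶠ q in 𝓝 p, TransitionGerm.sec g hg q ∈ s := by
      have h1 := ((TransitionGerm.contMDiffOn_sec g hg).contMDiffAt
        (g.open_source.mem_nhds hp)).continuousAt
      rw [ContinuousAt, TransitionGerm.sec_eq hp] at h1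
      exact h1.eventually hs
    obtain ⟨U, hU, hUo, hUp⟩ := mem_nhds_iff.1
      (hsec.and (e.eventuallyEq_nhds.and (g.open_source.mem_nhds hp)))
    obtain ⟨U', hU', rfl⟩ := hi.isInducing.isOpen_iff.1 hUo
    rw [h.extend_mk hi.continuous hg hf hp hp' e]
    refine ⟨TransitionGerm.germSet πM (f.restrOpen U' hU') (hf.restr hU'),
      (TransitionGerm.isOpen_germSet _ _).mem_nhds
        (TransitionGerm.mk_mem_germSet.2 ⟨⟨hp', hUp⟩, Filter.EventuallyEq.rfl⟩), ?_⟩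
    intro b
    refine h.extend_ind hi.continuous (P := fun b c =>
      c ∈ TransitionGerm.germSet πM (f.restrOpen U' hU') (hf.restr hU') → b ∈ s)
      (fun g' hg' q hq f' hf' hq' e' hm => ?_) b
    obtain ⟨⟨_, hqU⟩, e1⟩ := TransitionGerm.mk_mem_germSet.1 hm
    have e1 : f' =ᶠ[𝓝 (i q)] f := e1
    obtain ⟨hqs, e2, hqg⟩ := hU hqU
    have e3 : g' =ᶠ[𝓝 q] g := by
      filter_upwards [e', hi.continuous.continuousAt.eventually e1, e2] with y h1 h2 h3
      exact hi.injective (h1.symm.trans (h2.trans h3))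
    rw [TransitionGerm.sec_eq hqg] at hqs
    have e4 : TransitionGerm.mk g' hg' q hq = TransitionGerm.mk g hg q hqg :=
      TransitionGerm.mk_eq_mk.2 ⟨rfl, e3⟩
    rwa [e4]
  · intro a b
    refine h.extend_ind hi.continuous (P := fun a c => c = h.extend b → a = b)
      (fun g hg p hp f hf hp' e => ?_) a
    refine h.extend_ind hi.continuous (P := fun b c =>
      TransitionGerm.mk f hf (i p) hp' = c → TransitionGerm.mk g hg p hp = b)
      (fun g' hg' q hq f' hf' hq' e' he => ?_) b
    obtain ⟨h1, h2⟩ := TransitionGerm.mk_eq_mk.1 he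
    obtain rfl := hi.injective h1
    refine TransitionGerm.mk_eq_mk.2 ⟨rfl, ?_⟩
    filter_upwards [e, e', hi.continuous.continuousAt.eventually h2] with y h3 h4 h5
    exact hi.injective (h3.symm.trans (h5.trans h4))

theorem isSmoothEmbedding_extend (h : HasUniqueExtensions k n πN πM i)
    (hi : IsSmoothEmbedding (𝓡 k) (𝓡 n) ∞ i) :
    IsSmoothEmbedding (𝓡 k) (𝓡 n) ∞ h.extend := by
  have hs := h.contMDiff_extend hi.contMDiff
  refine ⟨?_, h.isEmbedding_extend hi.isEmbedding hs.continuous⟩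
  refine IsImmersionOfComplement.isImmersion (F := hi.isImmersion.complement) fun a => ?_
  refine IsImmersionAtOfComplement.of_isLocalDiffeomorphAt
    (hi.isImmersion.isImmersionOfComplement_complement a.src)
    (TransitionGerm.isLocalDiffeomorph_src a) (TransitionGerm.isLocalDiffeomorph_src (h.extend a))
    hs.continuous.continuousAt ?_
  exact Filter.Eventually.of_forall (h.src_extend hi.contMDiff.continuous)

variable [T2Space N] [SecondCountableTopology N] [T2Space M] [SecondCountableTopology M]

/-- The morphism of groupoids of germs which extends germs along `i`. -/
noncomputable def hom (h : HasUniqueExtensions k n πN πM i) (hi : ContMDiff (𝓡 k) (𝓡 n) ∞ i) :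
    (transitionGroupoid (n := k) πN).Hom (transitionGroupoid (n := n) πM) where
  obj := i
  arr := h.extend
  smooth_obj := hi
  smooth_arr := h.contMDiff_extend hi
  src_arr := h.src_extend hi.continuous
  tgt_arr := h.tgt_extend hi.continuous
  arr_mul := h.extend_comp hi.continuous
  arr_unit := h.extend_unit hi.continuous
  arr_inv := h.extend_inv hi.continuous

/-- A morphism over `i` is determined by `i`: if it sends `[g]_p` to `[f]_{i p}` then, by
continuity, it sends `[g]_q` to `[f]_{i q}` for `q` near `p`; comparing targets, `f` extends `g`. -/
theorem eq_hom (h : HasUniqueExtensions k n πN πM i) (hi : ContMDiff (𝓡 k) (𝓡 n) ∞ i)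
    (Ψ : (transitionGroupoid (n := k) πN).Hom (transitionGroupoid (n := n) πM)) (hΨ : Ψ.obj = i) :
    Ψ = h.hom hi := by
  have harr : ∀ a : TransitionGerm k πN, ∀ b : TransitionGerm n πM, Ψ.arr a = b →
      h.extend a = b := by
    refine TransitionGerm.ind fun g hg p hp => TransitionGerm.ind fun f hf x hx he => ?_
    have hsrc : ∀ q (hq : q ∈ g.source),
        (Ψ.arr (TransitionGerm.mk g hg q hq) : TransitionGerm n πM).src = i q := fun q hq =>
      (Ψ.src_arr _).trans (congrFun hΨ q)
    have htgt : ∀ q (hq : q ∈ g.source),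
        (Ψ.arr (TransitionGerm.mk g hg q hq) : TransitionGerm n πM).tgt = i (g q) := fun q hq =>
      (Ψ.tgt_arr _).trans (congrFun hΨ (g q))
    have hxp : x = i p := by
      have h1 := hsrc p hp
      rwa [he] at h1
    subst hxp
    refine h.extend_mk hi.continuous hg hf hp hx ?_
    have hc : ContinuousAt (fun q => (Ψ.arr (TransitionGerm.sec g hg q) : TransitionGerm n πM)) p :=
      Ψ.smooth_arr.continuous.continuousAt.comp ((TransitionGerm.contMDiffOn_sec g hg).contMDiffAt
        (g.open_source.mem_nhds hp)).continuousAt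
    have hm : TransitionGerm.germSet πM f hf ∈
        𝓝 (Ψ.arr (TransitionGerm.sec g hg p) : TransitionGerm n πM) := by
      refine (TransitionGerm.isOpen_germSet f hf).mem_nhds ?_
      rw [TransitionGerm.sec_eq hp]
      exact ⟨i p, hx, he⟩
    filter_upwards [hc.eventually hm, g.open_source.mem_nhds hp] with q hq hqg
    rw [TransitionGerm.sec_eq hqg] at hq
    obtain ⟨y, hy, h1⟩ := hq
    have h2 := hsrc q hqg
    have h3 := htgt q hqg
    rw [h1] at h2 h3
    have h2 : y = i q := h2
    subst h2
    exact h3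
  exact LieGroupoid.Hom.ext hΨ (funext fun a => (harr a _ rfl).symm)

end HasUniqueExtensions

end Extension

/-! ### Smooth maps into and between disjoint unions -/

/-- The complement of an immersion may be taken to be the standard space of dimension `n - k`; in
particular it does not depend on the immersion. -/
theorem Manifold.IsImmersionAt.isImmersionAtOfComplement_euclidean {k n : ℕ} {M N : Type*}
    [TopologicalSpace M] [ChartedSpace (EuclideanSpace ℝ (Fin k)) M]
    [TopologicalSpace N] [ChartedSpace (EuclideanSpace ℝ (Fin n)) N] {f : M → N} {p : M}
    (h : IsImmersionAt (𝓡 k) (𝓡 n) ∞ f p) :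
    IsImmersionAtOfComplement (EuclideanSpace ℝ (Fin (n - k))) (𝓡 k) (𝓡 n) ∞ f p := by
  have : FiniteDimensional ℝ (EuclideanSpace ℝ (Fin k) × h.complement) :=
    h.equiv.symm.toLinearEquiv.finiteDimensional
  have : FiniteDimensional ℝ h.complement :=
    Module.Finite.of_surjective (LinearMap.snd ℝ (EuclideanSpace ℝ (Fin k)) h.complement)
      LinearMap.snd_surjective
  have hd := h.equiv.toLinearEquiv.finrank_eq
  rw [Module.finrank_prod, finrank_euclideanSpace_fin, finrank_euclideanSpace_fin] at hd
  exact h.isImmersionAtOfComplement_complement.trans_F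
    (ContinuousLinearEquiv.ofFinrankEq (by rw [finrank_euclideanSpace_fin]; omega))

section Sigma

variable {n : ℕ} {ι : Type*} {M : ι → Type*} [∀ i, TopologicalSpace (M i)]
  [∀ i, ChartedSpace (EuclideanSpace ℝ (Fin n)) (M i)] [∀ i, IsManifold (𝓡 n) ∞ (M i)]

theorem isLocalDiffeomorph_sigmaMk (i : ι) :
    IsLocalDiffeomorph (𝓡 n) (𝓡 n) ∞ (Sigma.mk i : M i → Σ i, M i) := by
  intro x
  set φ := chartAt (EuclideanSpace ℝ (Fin n)) x
  set ψ := chartAt (EuclideanSpace ℝ (Fin n)) (⟨i, x⟩ : Σ i, M i)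
  have hψ : ∀ y, ψ ⟨i, y⟩ = φ y := fun y =>
    OpenPartialHomeomorph.lift_openEmbedding_apply _ (IsOpenEmbedding.sigmaMk (i := i))
  have hs : (φ ≫ₕ ψ.symm).source = φ.source := by
    rw [OpenPartialHomeomorph.trans_source]
    exact inter_eq_left.2 fun y hy => φ.map_source hy
  have ht : (φ ≫ₕ ψ.symm).target ⊆ ψ.source := by
    rw [OpenPartialHomeomorph.trans_target]
    exact inter_subset_left
  refine ⟨⟨(φ ≫ₕ ψ.symm).toPartialEquiv, (φ ≫ₕ ψ.symm).open_source,
    (φ ≫ₕ ψ.symm).open_target, ?_, ?_⟩, ?_, ?_⟩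
  · change ContMDiffOn _ _ _ (φ ≫ₕ ψ.symm) (φ ≫ₕ ψ.symm).source
    rw [hs]
    exact (contMDiffOn_chart_symm (I := 𝓡 n) (n := ∞)).comp (t := ψ.target) contMDiffOn_chart
      fun y hy => φ.map_source hy
  · change ContMDiffOn _ _ _ (φ ≫ₕ ψ.symm).symm (φ ≫ₕ ψ.symm).target
    exact (contMDiffOn_chart_symm (I := 𝓡 n) (n := ∞)).comp (t := φ.target)
      (contMDiffOn_chart.mono ht) fun y hy => ψ.map_source (ht hy)
  · change x ∈ (φ ≫ₕ ψ.symm).source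
    rw [hs]
    exact mem_chart_source _ x
  · intro y hy
    change y ∈ (φ ≫ₕ ψ.symm).source at hy
    rw [hs] at hy
    change _ = ψ.symm (φ y)
    rw [← hψ y, ψ.left_inv ⟨y, hy, rfl⟩]

/-- A smooth map into a disjoint union is locally a smooth map into one of the summands. -/
theorem ContMDiffOn.exists_sigma_lift {m : ℕ} {A : Type*} [TopologicalSpace A]
    [ChartedSpace (EuclideanSpace ℝ (Fin m)) A] {F : A → Σ i, M i} {O : Set A}
    (hF : ContMDiffOn (𝓡 m) (𝓡 n) ∞ F O) (hO : IsOpen O) {a : A} (ha : a ∈ O) {i : ι} {x : M i}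
    (hx : F a = ⟨i, x⟩) :
    ∃ (H : A → M i) (O' : Set A), IsOpen O' ∧ a ∈ O' ∧ O' ⊆ O ∧ ContMDiffOn (𝓡 m) (𝓡 n) ∞ H O' ∧
      ∀ y ∈ O', F y = ⟨i, H y⟩ := by
  have hl := isLocalDiffeomorph_sigmaMk (n := n) (M := M) i x
  refine ⟨hl.localInverse ∘ F, O ∩ F ⁻¹' hl.localInverse.source,
    hF.continuousOn.isOpen_inter_preimage hO hl.localInverse_open_source, ⟨ha, ?_⟩,
    inter_subset_left, hl.localInverse_contMDiffOn.comp (hF.mono inter_subset_left)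
      fun y hy => hy.2, fun y hy => (hl.localInverse_right_inv hy.2).symm⟩
  rw [mem_preimage, hx]
  exact hl.localInverse_mem_source

theorem isSmoothEmbedding_sigmaMap {k : ℕ} {κ : Type*} {N : κ → Type*}
    [∀ j, TopologicalSpace (N j)] [∀ j, ChartedSpace (EuclideanSpace ℝ (Fin k)) (N j)]
    [∀ j, IsManifold (𝓡 k) ∞ (N j)] {a : κ → ι} (ha : Function.Injective a)
    {f : ∀ j, N j → M (a j)} (hf : ∀ j, IsSmoothEmbedding (𝓡 k) (𝓡 n) ∞ (f j)) :
    IsSmoothEmbedding (𝓡 k) (𝓡 n) ∞ (Sigma.map a f) := by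
  have he := (isEmbedding_sigmaMap ha).2 fun j => (hf j).isEmbedding
  refine ⟨IsImmersionOfComplement.isImmersion (F := EuclideanSpace ℝ (Fin (n - k))) ?_, he⟩
  rintro ⟨j, p⟩
  have h1 := isLocalDiffeomorph_sigmaMk (n := k) (M := N) j p
  have h2 := isLocalDiffeomorph_sigmaMk (n := n) (M := M) (a j) (f j p)
  have h1p : h1.localInverse ⟨j, p⟩ = p := h1.localInverse_left_inv h1.localInverse_mem_target
  have h3 := ((hf j).isImmersion.isImmersionAt p).isImmersionAtOfComplement_euclidean
  rw [← h1p] at h3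
  refine h3.of_isLocalDiffeomorphAt h1.localInverse_isLocalDiffeomorphAt
    h2.localInverse_isLocalDiffeomorphAt he.continuous.continuousAt ?_
  rw [Filter.EventuallyEq, ← h1.map_nhds_eq, Filter.eventually_map]
  filter_upwards [h1.localInverse_eventuallyEq_left,
    (hf j).isEmbedding.continuous.continuousAt.eventually h2.localInverse_eventuallyEq_left]
    with q hq hq'
  exact hq'.trans (congrArg (f j) hq).symm

end Sigma

/-! ### Extending transitions of a very strong suborbifold cover -/

namespace OrbifoldChart

variable {n : ℕ} {X : Type v} [TopologicalSpace X] (φ : OrbifoldChart.{u} n X)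

theorem isLocalDiffeomorph_smul (γ : φ.Grp) :
    IsLocalDiffeomorph (𝓡 n) (𝓡 n) ∞ (fun p : φ.Dom => γ • p) := fun _ =>
  HasSmoothLeftInverseAt.isLocalDiffeomorphAt
    ⟨fun q => γ⁻¹ • q, univ, isOpen_univ, mem_univ _, (φ.smooth_smul γ⁻¹).contMDiffOn,
      Filter.Eventually.of_forall fun q => inv_smul_smul γ q⟩ (φ.smooth_smul γ)

/-- Two smooth maps into `Ũ` with the same projection to `X`, one of them a local diffeomorphism,
differ locally by an element of `Γ`. -/
theorem eventually_eq_smul_of_proj_eq {Z : Type*} [TopologicalSpace Z]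
    [ChartedSpace (EuclideanSpace ℝ (Fin n)) Z] {H b : Z → φ.Dom} {O : Set Z} {z : Z}
    (hO : IsOpen O) (hz : z ∈ O) (hH : ContMDiffOn (𝓡 n) (𝓡 n) ∞ H O)
    (hb : IsLocalDiffeomorphAt (𝓡 n) (𝓡 n) ∞ b z)
    (hπ : ∀ y ∈ O, φ.proj (H y) = φ.proj (b y)) :
    ∃ γ : φ.Grp, ∀ᶠ y in 𝓝 z, H y = γ • b y := by
  obtain ⟨γ, hγ⟩ := φ.eventually_eq_smul (h := H ∘ hb.localInverse)
    (O := hb.localInverse.source ∩ hb.localInverse ⁻¹' O) (p := b z)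
    (hb.localInverse_contMDiffOn.continuousOn.isOpen_inter_preimage hb.localInverse_open_source hO)
    (hH.comp (hb.localInverse_contMDiffOn.mono inter_subset_left) fun y hy => hy.2)
    (fun q hq => (hπ _ hq.2).trans (congrArg φ.proj (hb.localInverse_right_inv hq.1)))
    ⟨hb.localInverse_mem_source, by
      rw [mem_preimage, hb.localInverse_left_inv hb.localInverse_mem_target]
      exact hz⟩
  refine ⟨γ, ?_⟩
  filter_upwards [hb.contMDiffAt.continuousAt.eventually hγ, hb.localInverse_eventuallyEq_left]
    with y h1 h2
  have h2 : hb.localInverse (b y) = y := h2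
  rwa [Function.comp_apply, h2] at h1

end OrbifoldChart

/-- A transition of `N` which is read, through charts `a₁`, `a₂` of `N`, as a transition between
the restrictions of charts `e₁`, `e₂` of `M` extends to a transition of `M`, namely
`e₂ ∘ e₁⁻¹`. -/
theorem exists_isTransition_extension {n : ℕ} {N M W Z : Type*} {X : Type*}
    [TopologicalSpace N] [TopologicalSpace Z] [TopologicalSpace W]
    [ChartedSpace (EuclideanSpace ℝ (Fin n)) W]
    [TopologicalSpace M] [ChartedSpace (EuclideanSpace ℝ (Fin n)) M]
    {πM : M → X} {i : N → M} {s : Z → W} {e₁ e₂ : W → M} {a₁ a₂ : Z → N} {z : Z}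
    (hs : ContinuousAt s z) (he₁ : IsLocalDiffeomorphAt (𝓡 n) (𝓡 n) ∞ e₁ (s z))
    (he₂ : IsLocalDiffeomorphAt (𝓡 n) (𝓡 n) ∞ e₂ (s z)) (hπ : ∀ y, πM (e₁ y) = πM (e₂ y))
    (ha : Filter.map a₁ (𝓝 z) = 𝓝 (a₁ z)) (h₁ : ∀ y, i (a₁ y) = e₁ (s y))
    (h₂ : ∀ y, i (a₂ y) = e₂ (s y)) {g : N → N} (hg : g ∘ a₁ =ᶠ[𝓝 z] a₂) :
    ∃ f, IsTransition n πM f ∧ i (a₁ z) ∈ f.source ∧ f ∘ i =ᶠ[𝓝 (a₁ z)] i ∘ g := by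
  obtain ⟨Ψ, hz, hΨ⟩ := he₂
  set Φ := he₁.localInverse
  have hΦ : ∀ y ∈ Φ.target, Φ (e₁ y) = y := fun y hy => he₁.localInverse_left_inv hy
  refine ⟨(Φ.trans Ψ).toOpenPartialHomeomorph, ⟨(Φ.trans Ψ).contMDiffOn_toFun,
    (Φ.trans Ψ).contMDiffOn_invFun, ?_⟩, ?_, ?_⟩
  · rintro y ⟨hy, hy'⟩
    change πM (Ψ (Φ y)) = πM y
    have h3 : e₁ (Φ y) = y := he₁.localInverse_right_inv hy
    have h4 : e₂ (Φ y) = Ψ (Φ y) := hΨ hy'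
    rw [← h4, ← hπ, h3]
  · refine ⟨?_, ?_⟩
    · rw [h₁]
      exact he₁.localInverse_mem_source
    · change Φ (i (a₁ z)) ∈ Ψ.source
      rwa [h₁, hΦ _ he₁.localInverse_mem_target]
  · rw [Filter.EventuallyEq, ← ha, Filter.eventually_map]
    filter_upwards [hg, hs.eventually (Φ.open_target.mem_nhds he₁.localInverse_mem_target),
      hs.eventually (Ψ.open_source.mem_nhds hz)] with y h3 h4 h5
    change Ψ (Φ (i (a₁ y))) = i (g (a₁ y))
    rw [h₁, hΦ _ h4, ← hΨ h5, ← h₂]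
    exact congrArg i h3.symm

/-- An equidimensional smooth embedding which maps a `k`-dimensional submanifold into another one
restricts to a local diffeomorphism between them. -/
theorem EmbeddedSubmanifold.isLocalDiffeomorph_restrict {k n : ℕ} {M M' : Type u}
    [TopologicalSpace M] [ChartedSpace (EuclideanSpace ℝ (Fin n)) M]
    [TopologicalSpace M'] [ChartedSpace (EuclideanSpace ℝ (Fin n)) M']
    [IsManifold (𝓡 n) ∞ M] [IsManifold (𝓡 n) ∞ M']
    (Z : EmbeddedSubmanifold k n M) (V : EmbeddedSubmanifold k n M') {l : M → M'}
    (hl : IsSmoothEmbedding (𝓡 n) (𝓡 n) ∞ l) {a : Z.carrier → V.carrier}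
    (ha : ∀ y, (a y).1 = l y.1) : IsLocalDiffeomorph (𝓡 k) (𝓡 k) ∞ a := by
  have hc : Subtype.val ∘ a = l ∘ Subtype.val := funext ha
  have h1 : ContMDiff (𝓡 k) (𝓡 n) ∞ (Subtype.val ∘ a) := by
    rw [hc]
    exact hl.contMDiff.comp Z.isSmoothEmbedding.contMDiff
  have h2 : ContMDiff (𝓡 k) (𝓡 k) ∞ a :=
    (ContMDiff.iff_comp_isImmersion V.isSmoothEmbedding.isImmersion).2
      ⟨V.isSmoothEmbedding.isEmbedding.continuous_iff.2 h1.continuous, h1⟩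
  intro z
  refine HasSmoothLeftInverseAt.isLocalDiffeomorphAt ?_ h2
  refine HasSmoothLeftInverseAt.of_comp (g := Subtype.val) ?_ V.isSmoothEmbedding.contMDiff
  rw [hc]
  exact (hl.isImmersion.isImmersionAt _).hasSmoothLeftInverseAt.comp
    (Z.isSmoothEmbedding.isImmersion.isImmersionAt _).hasSmoothLeftInverseAt
    continuous_subtype_val.continuousAt

namespace ClosedSuborbifoldCover

variable {n k : ℕ} {X : Type v} [TopologicalSpace X] {ι : Type w} {𝒰 : ι → OrbifoldChart.{u} n X}
  {Y : Set X}

/-- Condition (1) of a very strong cover makes extensions of germs unique: a transition of `∐ Ũᵢ`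
which fixes `Ṽⱼ` near `p` is given near `p` by an element of `Γⱼ`, which is then trivial. -/
theorem IsVeryStrong.eventuallyEq_id {c : ClosedSuborbifoldCover k 𝒰 Y} (h : c.IsVeryStrong)
    {f : OpenPartialHomeomorph (Σ i, (𝒰 i).Dom) (Σ i, (𝒰 i).Dom)}
    (hf : IsTransition n (fun p : Σ i, (𝒰 i).Dom => (𝒰 p.1).proj p.2) f) {j : c.J}
    {p : (c.V j).carrier} (hp : (⟨j, p⟩ : Σ i, (𝒰 i).Dom) ∈ f.source)
    (he : ∀ᶠ q in 𝓝 p, f ⟨j, q.1⟩ = ⟨j, q.1⟩) : f =ᶠ[𝓝 ⟨j, p.1⟩] id := by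
  have hmk := isLocalDiffeomorph_sigmaMk (n := n) (M := fun i => (𝒰 i).Dom) j
  have hF : ContMDiffOn (𝓡 n) (𝓡 n) ∞ (fun q : (𝒰 j).Dom => f ⟨j, q⟩)
      (Sigma.mk (β := fun i => (𝒰 i).Dom) j.1 ⁻¹' f.source) :=
    hf.smooth.comp hmk.contMDiff.contMDiffOn fun _ hq => hq
  obtain ⟨H, O, hO, hpO, hOs, hH, hHf⟩ := hF.exists_sigma_lift
    (f.open_source.preimage hmk.contMDiff.continuous) hp (he.self_of_nhds)
  obtain ⟨γ, hγ⟩ := (𝒰 j).eventually_eq_smul hO hH (fun q hq => by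
    have h1 := hf.comp_eq _ (hOs hq)
    have h2 := hHf q hq
    rw [h2] at h1
    exact h1) hpO
  have h1 : ∀ᶠ q : (c.V j).carrier in 𝓝 p, γ • q.1 = q.1 := by
    filter_upwards [he, continuous_subtype_val.continuousAt.eventually hγ,
      continuous_subtype_val.continuousAt.eventually (hO.mem_nhds hpO)] with q h1 h2 h3
    have h4 := (hHf _ h3).symm.trans h1
    rw [← h2]
    exact eq_of_heq (Sigma.mk.inj h4).2
  obtain ⟨S, hS, hSo, hpS⟩ := mem_nhds_iff.1 h1
  obtain rfl := h.eq_one j γ S hSo ⟨p, hpS⟩ fun q hq => hS hq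
  rw [Filter.EventuallyEq, ← (hmk p.1).map_nhds_eq, Filter.eventually_map]
  filter_upwards [hγ, hO.mem_nhds hpO] with q h2 h3
  rw [hHf q h3, h2, one_smul]
  rfl

/-- Condition (2) of a very strong cover provides extensions of germs: over a chart `W` related to
both `Ṽ_{j₁}` and `Ṽ_{j₂}` a transition between them is, up to elements of `Δ_{j₁}` and `Δ_{j₂}`,
the restriction of the transition `l₂ ∘ l₁⁻¹` between `Ũ_{j₁}` and `Ũ_{j₂}`. -/
theorem IsVeryStrong.exists_extension [Countable ι] {c : ClosedSuborbifoldCover k 𝒰 Y}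
    (h : c.IsVeryStrong)
    {g : OpenPartialHomeomorph (Σ j, (c.inducedChart j).Dom) (Σ j, (c.inducedChart j).Dom)}
    (hg : IsTransition k (fun p : Σ j, (c.inducedChart j).Dom => (c.inducedChart p.1).proj p.2) g)
    {p : Σ j, (c.inducedChart j).Dom} (hp : p ∈ g.source) :
    ∃ f, IsTransition n (fun p : Σ i, (𝒰 i).Dom => (𝒰 p.1).proj p.2) f ∧
      c.inclusion p ∈ f.source ∧ f ∘ c.inclusion =ᶠ[𝓝 p] c.inclusion ∘ g := by
  obtain ⟨j₁, p₁⟩ := p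
  obtain ⟨⟨j₂, p₂⟩, hgp⟩ : ∃ q, g ⟨j₁, p₁⟩ = q := ⟨_, rfl⟩
  have hπ : (c.inducedChart j₂).proj p₂ = (c.inducedChart j₁).proj p₁ := by
    have := hg.comp_eq _ hp
    rwa [hgp] at this
  obtain ⟨W, -, Z, -, ⟨z, hz, hzx⟩, -, -, ⟨l₁, hl₁, hZ₁⟩, ⟨l₂, hl₂, hZ₂⟩⟩ := h.exists_chart j₁ j₂
    ((𝒰 j₁).proj p₁.1) ⟨⟨p₁.1, p₁.2, rfl⟩, ⟨p₂.1, p₂.2, congrArg Subtype.val hπ⟩⟩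
  -- the restrictions of `l₁` and `l₂` to `Z̃`
  let a₁ : Z.carrier → (c.inducedChart j₁).Dom := fun y => ⟨l₁ y.1, hZ₁ ⟨_, y.2, rfl⟩⟩
  let a₂ : Z.carrier → (c.inducedChart j₂).Dom := fun y => ⟨l₂ y.1, hZ₂ ⟨_, y.2, rfl⟩⟩
  have ha₁ : IsLocalDiffeomorph (𝓡 k) (𝓡 k) ∞ a₁ :=
    Z.isLocalDiffeomorph_restrict (c.V j₁) hl₁.embedding fun _ => rfl
  have ha₂ : IsLocalDiffeomorph (𝓡 k) (𝓡 k) ∞ a₂ :=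
    Z.isLocalDiffeomorph_restrict (c.V j₂) hl₂.embedding fun _ => rfl
  have haπ₁ : ∀ y, ((c.inducedChart j₁).proj (a₁ y)).1 = W.proj y.1 := fun y => hl₁.proj_comp y.1
  have haπ₂ : ∀ y, ((c.inducedChart j₂).proj (a₂ y)).1 = W.proj y.1 := fun y => hl₂.proj_comp y.1
  -- move `l₁ z` to `p₁`, which lies over the same point of `Y`
  obtain ⟨δ₁, hδ₁⟩ := (c.inducedChart j₁).exists_smul_eq (p := a₁ ⟨z, hz⟩) (q := p₁)
    (Subtype.ext ((haπ₁ _).trans hzx))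
  let A₁ : Z.carrier → Σ j, (c.inducedChart j).Dom := fun y => ⟨j₁, δ₁ • a₁ y⟩
  have hA₁ : IsLocalDiffeomorph (𝓡 k) (𝓡 k) ∞ A₁ := fun y =>
    ((ha₁ y).comp (hg := (c.inducedChart j₁).isLocalDiffeomorph_smul δ₁ _)).comp
      (hg := isLocalDiffeomorph_sigmaMk (M := fun j => (c.inducedChart j).Dom) j₁ _)
  have hA₁z : A₁ ⟨z, hz⟩ = ⟨j₁, p₁⟩ := congrArg (Sigma.mk j₁) hδ₁
  have hgA : ContMDiffOn (𝓡 k) (𝓡 k) ∞ (g ∘ A₁) (A₁ ⁻¹' g.source) :=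
    hg.smooth.comp hA₁.contMDiff.contMDiffOn fun _ hy => hy
  obtain ⟨H, O, hO, hzO, hOs, hH, hHg⟩ := hgA.exists_sigma_lift
    (g.open_source.preimage hA₁.contMDiff.continuous) (a := ⟨z, hz⟩) (i := j₂) (x := p₂)
    (by rw [mem_preimage, hA₁z]; exact hp) (by rw [Function.comp_apply, hA₁z, hgp])
  -- `H`, which is `g ∘ δ₁ ∘ l₁` on `Z̃`, and `l₂` have the same projection to `Y`
  obtain ⟨γ, hγ⟩ := (c.inducedChart j₂).eventually_eq_smul_of_proj_eq hO hzO hH (ha₂ _)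
    (fun y hy => by
      have h1 := hg.comp_eq _ (hOs hy)
      have h2 := hHg y hy
      rw [Function.comp_apply] at h2
      rw [h2] at h1
      refine h1.trans (((c.inducedChart j₁).proj_smul δ₁ _).trans ?_)
      exact Subtype.ext ((haπ₁ y).trans (haπ₂ y).symm))
  let A₂ : Z.carrier → Σ j, (c.inducedChart j).Dom := fun y => ⟨j₂, γ • a₂ y⟩
  -- representatives in `Δ_{j₁}` and `Δ_{j₂}` of the elements `δ₁` and `γ` of the quotients `Δ/K`
  obtain ⟨d₁, hd₁⟩ : ∃ d₁ : (𝒰 j₁).Grp, ∀ y, c.inclusion (A₁ y) = ⟨j₁, d₁ • l₁ y.1⟩ := by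
    induction δ₁ using QuotientGroup.induction_on with | H d => ?_
    exact ⟨d.1, fun y => rfl⟩
  obtain ⟨d₂, hd₂⟩ : ∃ d₂ : (𝒰 j₂).Grp, ∀ y, c.inclusion (A₂ y) = ⟨j₂, d₂ • l₂ y.1⟩ := by
    induction γ using QuotientGroup.induction_on with | H d => ?_
    exact ⟨d.1, fun y => rfl⟩
  have hE : ∀ {j : c.J} {l : W.Dom → (𝒰 j).Dom} (d : (𝒰 j).Grp), W.IsInjection (𝒰 j) l →
      IsLocalDiffeomorph (𝓡 n) (𝓡 n) ∞ (fun w => (⟨j, d • l w⟩ : Σ i, (𝒰 i).Dom)) := fun d hl w =>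
    (((hl.embedding.isImmersion.isImmersionAt w).isLocalDiffeomorphAt hl.embedding.contMDiff).comp
      (hg := (𝒰 _).isLocalDiffeomorph_smul d _)).comp
        (hg := isLocalDiffeomorph_sigmaMk (M := fun i => (𝒰 i).Dom) _ _)
  have key := exists_isTransition_extension (n := n)
    (πM := fun p : Σ i, (𝒰 i).Dom => (𝒰 p.1).proj p.2) (i := c.inclusion) (s := Subtype.val)
    (a₁ := A₁) (a₂ := A₂) (z := ⟨z, hz⟩) (g := g) continuous_subtype_val.continuousAt
    (hE d₁ hl₁ z) (hE d₂ hl₂ z)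
    (fun w => (((𝒰 j₁).proj_smul d₁ _).trans (hl₁.proj_comp w)).trans
      (((𝒰 j₂).proj_smul d₂ _).trans (hl₂.proj_comp w)).symm)
    (hA₁ _).map_nhds_eq hd₁ hd₂ (by
      filter_upwards [hγ, hO.mem_nhds hzO] with y h1 h2
      exact (hHg y h2).trans (congrArg (Sigma.mk j₂) h1))
  rwa [hA₁z] at key

theorem IsVeryStrong.hasUniqueExtensions [Countable ι] {c : ClosedSuborbifoldCover k 𝒰 Y}
    (h : c.IsVeryStrong) : HasUniqueExtensions k n
      (fun p : Σ j, (c.inducedChart j).Dom => (c.inducedChart p.1).proj p.2)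
      (fun p : Σ i, (𝒰 i).Dom => (𝒰 p.1).proj p.2) c.inclusion where
  exists_extension _ hg _ hp := h.exists_extension hg hp
  eventuallyEq_id := by
    rintro f hf ⟨j, p⟩ hp he
    refine h.eventuallyEq_id hf (j := j) (p := p) hp ?_
    have hmk := isLocalDiffeomorph_sigmaMk (n := k) (M := fun j => (c.inducedChart j).Dom) j p
    exact hmk.contMDiffAt.continuousAt.eventually he

theorem isSmoothEmbedding_inclusion [Countable ι] (c : ClosedSuborbifoldCover k 𝒰 Y) :
    IsSmoothEmbedding (𝓡 k) (𝓡 n) ∞ c.inclusion :=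
  isSmoothEmbedding_sigmaMap (N := fun j => (c.V j).carrier) (M := fun i => (𝒰 i).Dom)
    (f := fun _ => Subtype.val) Subtype.val_injective fun j => (c.V j).isSmoothEmbedding

/-- Compatibility with the inclusion `Y ⊆ X` only concerns the map on objects. -/
theorem isOverInclusion_of_obj_eq [Countable ι] (c : ClosedSuborbifoldCover k 𝒰 Y)
    {Φ : (germGroupoid c.inducedChart).Hom (germGroupoid 𝒰)} (hΦ : Φ.obj = c.inclusion) :
    c.IsOverInclusion Φ := by
  intro z
  induction z using Quotient.inductionOn with | h p => ?_
  change (𝒰 (Φ.obj p).1).proj (Φ.obj p).2 = _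
  rw [hΦ]
  rfl

theorem IsVeryStrong.exists_unique_hom [Countable ι] {c : ClosedSuborbifoldCover k 𝒰 Y}
    (h : c.IsVeryStrong) : ∃ Φ : (germGroupoid c.inducedChart).Hom (germGroupoid 𝒰),
      Φ.IsEmbedding ∧ Φ.obj = c.inclusion ∧ c.IsOverInclusion Φ ∧
      ∀ Ψ : (germGroupoid c.inducedChart).Hom (germGroupoid 𝒰),
        Ψ.IsEmbedding → Ψ.obj = c.inclusion → Ψ = Φ := by
  have hi := c.isSmoothEmbedding_inclusion
  refine ⟨h.hasUniqueExtensions.hom hi.contMDiff,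
    ⟨hi, h.hasUniqueExtensions.isSmoothEmbedding_extend hi⟩, rfl,
    c.isOverInclusion_of_obj_eq rfl, fun Ψ _ hΨ => h.hasUniqueExtensions.eq_hom hi.contMDiff Ψ hΨ⟩

theorem IsVeryStrong.isStrong [Countable ι] {c : ClosedSuborbifoldCover k 𝒰 Y}
    (h : c.IsVeryStrong) : c.IsStrong :=
  let ⟨Φ, hΦ, _, hΦ', _⟩ := h.exists_unique_hom
  ⟨Φ, hΦ, hΦ'⟩

end ClosedSuborbifoldCover

theorem mainTheorem2 {X : Type v} [TopologicalSpace X] [T2Space X] [SecondCountableTopology X]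
    {n k : ℕ} :
    (∀ {ι : Type w} [Countable ι] (𝒰 : ι → OrbifoldChart.{u} n X), IsOrbifoldAtlas 𝒰 →
      ∀ (Y : Set X) (c : ClosedSuborbifoldCover k 𝒰 Y), c.IsVeryStrong →
        c.IsStrong ∧
        ∃ Φ : (germGroupoid c.inducedChart).Hom (germGroupoid 𝒰),
          Φ.IsEmbedding ∧ Φ.obj = c.inclusion ∧ c.IsOverInclusion Φ ∧
          ∀ Ψ : (germGroupoid c.inducedChart).Hom (germGroupoid 𝒰),
            Ψ.IsEmbedding → Ψ.obj = c.inclusion → Ψ = Φ) ∧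
    (∀ 𝒜 : Set (OrbifoldChart.{u} n X), IsMaximalOrbifoldAtlas 𝒜 →
      ∀ Y : Set X, IsVeryStrongSuborbifold k 𝒜 Y → IsStrongSuborbifold k 𝒜 Y) := by
  refine ⟨fun 𝒰 _ Y c h => ⟨h.isStrong, h.exists_unique_hom⟩, ?_⟩
  rintro 𝒜 - Y ⟨ι, hι, 𝒰, hA, hU, c, hc⟩
  exact ⟨ι, hι, 𝒰, hA, hU, c, hc.isStrong⟩
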